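/- Let $p,q,h>0$ be real numbers and let $a_k=q\,h^k k^{p-1}$ for $k\ge 1$ (the basic case is $h=1$, i.e. $a_k=qk^{p-1}$). For $N\ge 1$ let $\Omega_N$ be the set of all partitions $\eta=(n_1,\dots,n_N)$ of $N$, where $n_j\ge 0$ are integers with $\sum_{j=1}^N j n_j=N$, and let $\mu_N$ be the probability measure on $\Omega_N$ given by $$\mu_N(\eta)=\frac1{c_N}\,\frac{a_1^{n_1}a_2^{n_2}\cdots a_N^{n_N}}{n_1!\,n_2!\cdots n_N!},\qquad c_N=\sum_{\eta\in\Omega_N}\frac{a_1^{n_1}a_2^{n_2}\cdots a_N^{n_N}}{n_1!\,n_2!\cdots n_N!}.$$ Let $\nu_N=n_1+\dots+n_N$ be the number of groups of a random partition $\eta$ with law $\mu_N$. Put $$Q_p=p^{-1}\,\Gamma(p+1)^{\frac1{p+1}},\qquad d_p=\frac{Q_p}{p+1},\qquad \widetilde Q_p=q^{\frac1{p+1}}Q_p,\qquad \widetilde d_p=q^{\frac1{p+1}}d_p.$$ Then, as $N\to\infty$, $$\frac{\nu_N-\widetilde Q_p\,N^{\frac p{p+1}}}{\sqrt{\widetilde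 d_p}\;N^{\frac p{2p+2}}}\;\Rightarrow\; N(0,1),$$ where $\Rightarrow$ denotes weak convergence (convergence in distribution) and $N(0,1)$ is the standard normal law. -/

import Mathlib

open MeasureTheory ProbabilityTheory Filter

open scoped ENNReal Nat

namespace GroupCLT

/-- The finite set `Ω_N` of all partitions of `N` is `Nat.Partition N`, a partition being coded by
the multiset of its parts; `groupCount η j` is `n_j`, the number of groups of size `j`. -/
def groupCount {N : ℕ} (η : Nat.Partition N) (j : ℕ) : ℕ := η.parts.count j

/-- The number of groups `ν_N(η) = n_1 + ⋯ + n_N`. -/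
def numGroups {N : ℕ} (η : Nat.Partition N) : ℕ := ∑ j ∈ Finset.Icc 1 N, groupCount η j

/-- The weight `a_1^{n_1} ⋯ a_N^{n_N} / (n_1! ⋯ n_N!)` of a partition. -/
noncomputable def weight (a : ℕ → ℝ) {N : ℕ} (η : Nat.Partition N) : ℝ :=
  ∏ j ∈ Finset.Icc 1 N, a j ^ groupCount η j / ((groupCount η j)! : ℝ)

/-- The partition function `c_N = ∑_{η ∈ Ω_N} weight a η`. -/
noncomputable def partitionFunction (a : ℕ → ℝ) (N : ℕ) : ℝ :=
  ∑ η : Nat.Partition N, weight a η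

theorem weight_pos {a : ℕ → ℝ} (ha : ∀ k, 1 ≤ k → 0 < a k) {N : ℕ} (η : Nat.Partition N) :
    0 < weight a η :=
  Finset.prod_pos fun j hj =>
    div_pos (pow_pos (ha j (Finset.mem_Icc.1 hj).1) _) (by positivity)

theorem partitionFunction_pos {a : ℕ → ℝ} (ha : ∀ k, 1 ≤ k → 0 < a k) (N : ℕ) :
    0 < partitionFunction a N :=
  Finset.sum_pos (fun η _ => weight_pos ha η) Finset.univ_nonempty

theorem sum_ofReal_weight_div {a : ℕ → ℝ} (ha : ∀ k, 1 ≤ k → 0 < a k) (N : ℕ) :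
    ∑ η : Nat.Partition N, ENNReal.ofReal (weight a η / partitionFunction a N) = 1 := by
  rw [← ENNReal.ofReal_sum_of_nonneg fun η _ =>
    (div_pos (weight_pos ha η) (partitionFunction_pos ha N)).le, ← Finset.sum_div]
  change ENNReal.ofReal (partitionFunction a N / partitionFunction a N) = 1
  rw [div_self (partitionFunction_pos ha N).ne', ENNReal.ofReal_one]

/-- The probability mass function `μ_N(η) = c_N⁻¹ a_1^{n_1} ⋯ a_N^{n_N} / (n_1! ⋯ n_N!)` on `Ω_N`
induced by a positive parameter function `a`. -/
noncomputable def equilibriumPMF (a : ℕ → ℝ) (ha : ∀ k, 1 ≤ k → 0 < a k) (N : ℕ) :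
    PMF (Nat.Partition N) :=
  PMF.ofFintype (fun η => ENNReal.ofReal (weight a η / partitionFunction a N))
    (sum_ofReal_weight_div ha N)

/-- Every subset of the finite set `Ω_N` is measurable. -/
instance instMeasurableSpacePartition (N : ℕ) : MeasurableSpace (Nat.Partition N) := ⊤

/-- `μ_N` as a measure on `Ω_N`. -/
noncomputable def equilibriumMeasure (a : ℕ → ℝ) (ha : ∀ k, 1 ≤ k → 0 < a k) (N : ℕ) :
    Measure (Nat.Partition N) :=
  (equilibriumPMF a ha N).toMeasure

instance instIsProbabilityMeasureEquilibrium (a : ℕ → ℝ) (ha : ∀ k, 1 ≤ k → 0 < a k) (N : ℕ) :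
    IsProbabilityMeasure (equilibriumMeasure a ha N) :=
  PMF.toMeasure.isProbabilityMeasure (equilibriumPMF a ha N)

/-- The parameter function `a_k = q h^k k^{p-1}`, of interest for `k ≥ 1` only. -/
noncomputable def param (q h p : ℝ) (k : ℕ) : ℝ := q * h ^ k * (k : ℝ) ^ (p - 1)

theorem param_pos {q h : ℝ} (hq : 0 < q) (hh : 0 < h) (p : ℝ) :
    ∀ k : ℕ, 1 ≤ k → 0 < param q h p k := fun k hk =>
  mul_pos (mul_pos hq (pow_pos hh k)) (Real.rpow_pos_of_pos (by exact_mod_cast hk) _)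

/-- `Q_p = p⁻¹ Γ(p+1)^{1/(p+1)}`. -/
noncomputable def Q (p : ℝ) : ℝ := p⁻¹ * Real.Gamma (p + 1) ^ (1 / (p + 1))

/-- `d_p = Q_p / (p+1)`. -/
noncomputable def d (p : ℝ) : ℝ := Q p / (p + 1)

/-- `Q̃_p = q^{1/(p+1)} Q_p`. -/
noncomputable def QTilde (q p : ℝ) : ℝ := q ^ (1 / (p + 1)) * Q p

/-- `d̃_p = q^{1/(p+1)} d_p`. -/
noncomputable def dTilde (q p : ℝ) : ℝ := q ^ (1 / (p + 1)) * d p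

/-- `(ν_N - Q̃_p N^{p/(p+1)}) / (√d̃_p N^{p/(2p+2)})` as a random variable on `Ω_N`. -/
noncomputable def normalizedNumGroups (q p : ℝ) (N : ℕ) (η : Nat.Partition N) : ℝ :=
  ((numGroups η : ℝ) - QTilde q p * (N : ℝ) ^ (p / (p + 1))) /
    (√(dTilde q p) * (N : ℝ) ^ (p / (2 * p + 2)))

end GroupCLT

namespace GroupCLT

/-! The mechanism is conditioning a Poisson model (Khinchin's method). Let X_j be independent
Poisson variables with means l_j = a_j r^j for 1 ≤ j ≤ N. Conditioned on ∑ j X_j = N, the vector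
(X_j) has law μ_N, whatever r > 0 is. So the characteristic function of ν_N is a quotient of two
integrals over θ ∈ [-π, π] of the joint characteristic function of (∑ X_j, ∑ j X_j), and c_N needs
no separate asymptotics (`charFun_map_numGroups`).

Take r = e^{-σ}/h, which removes h, and choose σ so that q Γ(p+1) σ^{-(p+1)} = N, the leading-order
mean of ∑ j X_j. The moments ∑ l_j j^k are then asymptotic to q Γ(p+k) σ^{-(p+k)}. With ε = σ^{p/2},
u = τε and θ = yσε, the centred joint characteristic function tends to exp(-(τ² g₀ + 2τy g₁ + y²
g₂)/2), where g_k = q Γ(p+k) (`tendsto_logChar`). Integrating over y leaves the conditional variance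
g₀ - g₁²/g₂ = q Γ(p)/(p+1), which is the stated normalization.

Two estimates carry the argument. The means must be known to relative error o(ε), which follows from
∑ j^{s-1} e^{-σj} = Γ(s) σ^{-s} + O(1) (`exists_abs_tsum_sub_le`). The passage to the limit under
the integral needs a majorant valid up to |θ| = π (`exists_norm_exp_logChar_le`), obtained by
comparing the phases of pairs of indices (`min_sq_le_sum_one_sub_cos`). -/

/-! ### Partitions as vectors of group counts -/

theorem sum_mul_groupCount {N : ℕ} (η : Nat.Partition N) :
    ∑ j ∈ Finset.Icc 1 N, j * groupCount η j = N := by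
  have h := η.toFinsuppAntidiag_mem_finsuppAntidiag
  rw [Finset.mem_finsuppAntidiag] at h
  simpa [Nat.Partition.toFinsuppAntidiag, groupCount, mul_comm] using h.1

theorem groupCount_eq_zero {N : ℕ} (η : Nat.Partition N) {j : ℕ} (hj : j ∉ Finset.Icc 1 N) :
    groupCount η j = 0 := by
  refine Multiset.count_eq_zero.2 fun h => hj ?_
  exact Finset.mem_Icc.2 ⟨η.parts_pos h, η.le_of_mem_parts h⟩

theorem groupCount_injective (N : ℕ) :
    Function.Injective (fun (η : Nat.Partition N) => groupCount η) := by
  intro η η' h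
  refine Nat.Partition.ext (Multiset.ext.2 fun j => ?_)
  exact congrFun h j

theorem exists_groupCount_eq {N : ℕ} {k : ℕ → ℕ} (hk : ∀ j ∉ Finset.Icc 1 N, k j = 0)
    (hN : ∑ j ∈ Finset.Icc 1 N, j * k j = N) : ∃ η : Nat.Partition N, groupCount η = k := by
  classical
  set s : Multiset ℕ := ∑ j ∈ Finset.Icc 1 N, Multiset.replicate (k j) j with hs
  refine ⟨⟨s, ?_, ?_⟩, ?_⟩
  · intro i hi
    rw [hs, Multiset.mem_sum] at hi
    obtain ⟨j, hj, hij⟩ := hi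
    rw [Multiset.eq_of_mem_replicate hij]
    exact (Finset.mem_Icc.1 hj).1
  · rw [hs, Multiset.sum_sum]
    simpa [mul_comm] using hN
  · funext j
    simp only [groupCount, hs, Multiset.count_sum', Multiset.count_replicate]
    by_cases hj : j ∈ Finset.Icc 1 N
    · simp [Finset.sum_ite_eq', hj]
    · simp [Finset.sum_ite_eq', hj, hk j hj]

/-- Sums over the partitions of `N` are sums over the vectors of group counts. -/
theorem sum_partition_eq {M : Type*} [AddCommMonoid M] (N : ℕ) (f : (ℕ → ℕ) → M) :
    ∑ η : Nat.Partition N, f (groupCount η) =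
      ∑ n ∈ Finset.range (N + 1), ∑ k ∈ (Finset.Icc 1 N).piAntidiag n,
        if ∑ j ∈ Finset.Icc 1 N, j * k j = N then f k else 0 := by
  classical
  rw [← Finset.sum_image (f := f) (g := fun η : Nat.Partition N => groupCount η)
    fun a _ b _ h => groupCount_injective N h]
  simp_rw [← Finset.sum_filter]
  rw [← Finset.sum_biUnion]
  · refine Finset.sum_congr ?_ fun _ _ => rfl
    ext k
    simp only [Finset.mem_image, Finset.mem_univ, true_and, Finset.mem_biUnion, Finset.mem_range,
      Finset.mem_filter, Finset.mem_piAntidiag]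
    constructor
    · rintro ⟨η, rfl⟩
      refine ⟨∑ j ∈ Finset.Icc 1 N, groupCount η j, Nat.lt_succ_of_le ?_, ⟨rfl, fun j hj => ?_⟩,
        sum_mul_groupCount η⟩
      · conv_rhs => rw [← sum_mul_groupCount η]
        exact Finset.sum_le_sum fun j hj =>
          Nat.le_mul_of_pos_left _ (Finset.mem_Icc.1 hj).1
      · by_contra h
        exact hj (groupCount_eq_zero η h)
    · rintro ⟨n, -, ⟨-, h0⟩, hN⟩
      exact exists_groupCount_eq (fun j hj => by_contra fun h => hj (h0 j h)) hN
  · intro a _ b _ hab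
    refine Finset.disjoint_left.2 fun k hk hk' => hab ?_
    rw [Finset.mem_filter, Finset.mem_piAntidiag] at hk hk'
    exact hk.1.1.symm.trans hk'.1.1

/-! ### Fourier inversion of the generating function -/

theorem integral_exp_int_mul_I (n : ℤ) :
    ∫ θ in (-Real.pi)..Real.pi, Complex.exp ((n * θ : ℝ) * Complex.I) =
      if n = 0 then 2 * (Real.pi : ℂ) else 0 := by
  split_ifs with h
  · subst h
    simp
    ring
  · have hn : (n : ℂ) * Complex.I ≠ 0 := by simp [h]
    have h1 : ∀ θ : ℝ, Complex.exp ((n * θ : ℝ) * Complex.I) =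
        Complex.exp ((n : ℂ) * Complex.I * θ) := fun θ => by
      congr 1; push_cast; ring
    simp_rw [h1]
    rw [integral_exp_mul_complex hn]
    have : Complex.exp ((n : ℂ) * Complex.I * (Real.pi : ℝ)) =
        Complex.exp ((n : ℂ) * Complex.I * ((-Real.pi : ℝ) : ℂ)) := by
      rw [Complex.exp_eq_exp_iff_exists_int]
      exact ⟨n, by push_cast; ring⟩
    rw [this]; simp

/-- The `n`-th term of the exponential series of a trigonometric polynomial. -/
theorem pow_div_factorial_eq (N n : ℕ) (b : ℕ → ℂ) (x : ℂ) :
    (∑ j ∈ Finset.Icc 1 N, b j * x ^ j) ^ n / (n ! : ℂ) =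
      ∑ k ∈ (Finset.Icc 1 N).piAntidiag n,
        (∏ j ∈ Finset.Icc 1 N, b j ^ k j / ((k j)! : ℂ)) * x ^ ∑ j ∈ Finset.Icc 1 N, j * k j := by
  rw [Finset.sum_pow_eq_sum_piAntidiag, Finset.sum_div]
  refine Finset.sum_congr rfl fun k hk => ?_
  have hn : ∑ j ∈ Finset.Icc 1 N, k j = n := (Finset.mem_piAntidiag.1 hk).1
  have hm := Nat.multinomial_spec (Finset.Icc 1 N) k
  rw [hn] at hm
  have hm' : (∏ j ∈ Finset.Icc 1 N, ((k j)! : ℂ)) * (Nat.multinomial (Finset.Icc 1 N) k : ℂ) =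
      (n ! : ℂ) := by exact_mod_cast hm
  have h0 : (n ! : ℂ) ≠ 0 := by exact_mod_cast n.factorial_ne_zero
  have h1 : (∏ j ∈ Finset.Icc 1 N, ((k j)! : ℂ)) ≠ 0 :=
    Finset.prod_ne_zero_iff.2 fun j _ => by exact_mod_cast (k j).factorial_ne_zero
  simp_rw [mul_pow, ← pow_mul]
  rw [Finset.prod_mul_distrib, Finset.prod_pow_eq_pow_sum, Finset.prod_div_distrib,
    div_eq_iff h0, ← hm']
  field_simp

/-- The coefficients of `exp (∑ b_j x ^ j)`, extracted by Fourier inversion, are the partition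
functions of the weights `b`. -/
theorem integral_exp_sum_mul_exp (N : ℕ) (b : ℕ → ℂ) :
    ∫ θ in (-Real.pi)..Real.pi,
      Complex.exp (∑ j ∈ Finset.Icc 1 N, b j * Complex.exp (θ * Complex.I) ^ j) *
        Complex.exp (-(N * θ : ℝ) * Complex.I) =
      2 * Real.pi * ∑ η : Nat.Partition N,
        ∏ j ∈ Finset.Icc 1 N, b j ^ groupCount η j / ((groupCount η j)! : ℂ) := by
  set S : ℝ → ℂ := fun θ => ∑ j ∈ Finset.Icc 1 N, b j * Complex.exp (θ * Complex.I) ^ j with hS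
  set B : ℝ := ∑ j ∈ Finset.Icc 1 N, ‖b j‖ with hB
  have hSB : ∀ θ, ‖S θ‖ ≤ B := fun θ => by
    refine (norm_sum_le _ _).trans (Finset.sum_le_sum fun j _ => ?_)
    rw [norm_mul, norm_pow, Complex.norm_exp_ofReal_mul_I, one_pow, mul_one]
  have hScont : Continuous S := by fun_prop
  set e : ℝ → ℂ := fun θ => Complex.exp (-(N * θ : ℝ) * Complex.I) with he
  have hecont : Continuous e := by fun_prop
  have henorm : ∀ θ, ‖e θ‖ = 1 := fun θ => by
    have := Complex.norm_exp_ofReal_mul_I (-(N * θ))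
    rwa [Complex.ofReal_neg] at this
  -- Expanding the outer exponential grades the integral by the number of groups n; the exchange of
  -- sum and integral is dominated by B^n / n!.
  have hsum : HasSum (fun n : ℕ => ∫ θ in (-Real.pi)..Real.pi, S θ ^ n / (n ! : ℂ) * e θ)
      (∫ θ in (-Real.pi)..Real.pi, Complex.exp (S θ) * e θ) := by
    refine intervalIntegral.hasSum_integral_of_dominated_convergence
      (fun n _ => B ^ n / n !) (fun n => ?_) (fun n => ?_) ?_ ?_ ?_
    · exact Continuous.aestronglyMeasurable (by fun_prop)
    · refine ae_of_all _ fun θ _ => ?_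
      rw [norm_mul, henorm, mul_one, norm_div, norm_pow, Complex.norm_natCast]
      gcongr
      exact hSB θ
    · exact ae_of_all _ fun θ _ => Real.summable_pow_div_factorial B
    · simp
    · refine ae_of_all _ fun θ _ => ?_
      refine HasSum.mul_right _ ?_
      rw [Complex.exp_eq_exp_ℂ]
      exact NormedSpace.expSeries_div_hasSum_exp (S θ)
  have hterm : ∀ n : ℕ, ∫ θ in (-Real.pi)..Real.pi, S θ ^ n / (n ! : ℂ) * e θ =
      ∑ k ∈ (Finset.Icc 1 N).piAntidiag n, if ∑ j ∈ Finset.Icc 1 N, j * k j = N then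
        2 * (Real.pi : ℂ) * ∏ j ∈ Finset.Icc 1 N, b j ^ k j / ((k j)! : ℂ) else 0 := by
    intro n
    have h1 : ∀ θ : ℝ, S θ ^ n / (n ! : ℂ) * e θ = ∑ k ∈ (Finset.Icc 1 N).piAntidiag n,
        (∏ j ∈ Finset.Icc 1 N, b j ^ k j / ((k j)! : ℂ)) *
          Complex.exp ((((∑ j ∈ Finset.Icc 1 N, j * k j : ℕ) - N : ℤ) * θ : ℝ) * Complex.I) := by
      intro θ
      rw [hS, pow_div_factorial_eq, Finset.sum_mul]
      refine Finset.sum_congr rfl fun k _ => ?_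
      rw [mul_assoc, he, ← Complex.exp_nat_mul, ← Complex.exp_add]
      congr 2
      push_cast
      ring
    simp_rw [h1]
    rw [intervalIntegral.integral_finsetSum
      fun k _ => Continuous.intervalIntegrable (by fun_prop) _ _]
    refine Finset.sum_congr rfl fun k _ => ?_
    rw [intervalIntegral.integral_const_mul, integral_exp_int_mul_I]
    by_cases h : ∑ j ∈ Finset.Icc 1 N, j * k j = N
    · simp [h, mul_comm]
    · have h' : ((∑ j ∈ Finset.Icc 1 N, j * k j : ℕ) - N : ℤ) ≠ 0 := by
        rw [sub_ne_zero]; exact_mod_cast h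
      rw [if_neg h', if_neg h, mul_zero]
  -- Parts are at least 1, so a partition of N has at most N groups and the series is a finite sum.
  have hzero : ∀ n ∉ Finset.range (N + 1),
      ∫ θ in (-Real.pi)..Real.pi, S θ ^ n / (n ! : ℂ) * e θ = 0 := by
    intro n hn
    rw [hterm]
    refine Finset.sum_eq_zero fun k hk => if_neg fun h => hn ?_
    rw [Finset.mem_range, Nat.lt_succ_iff, ← (Finset.mem_piAntidiag.1 hk).1]
    conv_rhs => rw [← h]
    exact Finset.sum_le_sum fun j hj => Nat.le_mul_of_pos_left _ (Finset.mem_Icc.1 hj).1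
  rw [hsum.unique (hasSum_sum_of_ne_finset_zero hzero), Finset.mul_sum,
    sum_partition_eq N fun k => 2 * (Real.pi : ℂ) * ∏ j ∈ Finset.Icc 1 N, b j ^ k j / ((k j)! : ℂ)]
  exact Finset.sum_congr rfl fun n _ => hterm n

/-! ### Exponentially damped power sums and Gamma integrals -/

/-- The Laplace transform of `x ^ (s - 1)` in the right half-plane. -/
theorem integral_rpow_mul_cexp_neg_mul {s : ℝ} (hs : 0 < s) {w : ℂ} (hw : 0 < w.re) :
    ∫ x in Set.Ioi (0 : ℝ), ((x ^ (s - 1) : ℝ) : ℂ) * Complex.exp (-(w * x)) =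
      Real.Gamma s * w ^ (-s : ℂ) := by
  -- Identity theorem: both sides are holomorphic on the half-plane and agree on the positive reals,
  -- which accumulate at 1.
  set U : Set ℂ := {w | 0 < w.re} with hU
  have hUo : IsOpen U := isOpen_lt continuous_const Complex.continuous_re
  have hUc : IsPreconnected U := (convex_halfSpace_re_gt 0).isPreconnected
  set F : ℂ → ℂ := fun w =>
    ∫ x in Set.Ioi (0 : ℝ), ((x ^ (s - 1) : ℝ) : ℂ) * Complex.exp (-(w * x)) with hF
  have hint : ∀ {a r : ℝ}, 0 < a → 0 < r →
      IntegrableOn (fun x : ℝ => x ^ (a - 1) * Real.exp (-(r * x))) (Set.Ioi 0) := by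
    intro a r ha hr
    have := integrableOn_rpow_mul_exp_neg_mul_rpow (s := a - 1) (p := 1) (b := r) (by linarith)
      one_pos hr
    simpa [neg_mul] using this
  have hmeas : ∀ w : ℂ, AEStronglyMeasurable
      (fun x : ℝ => ((x ^ (s - 1) : ℝ) : ℂ) * Complex.exp (-(w * x)))
      (volume.restrict (Set.Ioi 0)) := fun w =>
    Measurable.aestronglyMeasurable (by fun_prop)
  have hnorm : ∀ (w : ℂ) (x : ℝ), ‖Complex.exp (-(w * x))‖ = Real.exp (-(w.re * x)) := by
    intro w x
    rw [Complex.norm_exp]; simp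
  have hFd : DifferentiableOn ℂ F U := by
    intro w₀ hw₀
    have hw₀ : 0 < w₀.re := hw₀
    refine DifferentiableAt.differentiableWithinAt ?_
    refine (hasDerivAt_integral_of_dominated_loc_of_deriv_le
      (s := Metric.ball w₀ (w₀.re / 2))
      (F' := fun w x => ((x ^ (s - 1) : ℝ) : ℂ) * (Complex.exp (-(w * x)) * (-(1 * x))))
      (bound := fun x => x ^ (s + 1 - 1) * Real.exp (-(w₀.re / 2 * x)))
      (Metric.ball_mem_nhds w₀ (by positivity)) (Eventually.of_forall hmeas) ?_ ?_ ?_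
      (hint (by linarith) (by positivity)) ?_).2.differentiableAt
    · refine (hint hs hw₀).mono' (hmeas _) ?_
      refine (ae_restrict_iff' measurableSet_Ioi).2 (ae_of_all _ fun x hx => ?_)
      rw [norm_mul, hnorm, Complex.norm_real, Real.norm_of_nonneg (Real.rpow_nonneg hx.le _)]
    · exact Measurable.aestronglyMeasurable (by fun_prop)
    · refine (ae_restrict_iff' measurableSet_Ioi).2 (ae_of_all _ fun x hx w hw => ?_)
      have hx : 0 < x := hx
      have hre : w₀.re / 2 ≤ w.re := by
        have h1 := (Complex.abs_re_le_norm (w - w₀)).trans (mem_ball_iff_norm.1 hw).le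
        rw [Complex.sub_re] at h1
        linarith [(abs_le.1 h1).1]
      rw [norm_mul, norm_mul, hnorm, Complex.norm_real,
        Real.norm_of_nonneg (Real.rpow_nonneg hx.le _), norm_neg, one_mul, Complex.norm_real,
        Real.norm_of_nonneg hx.le, add_sub_cancel_right, mul_comm (Real.exp _), ← mul_assoc,
        Real.rpow_sub_one hx.ne', div_mul_cancel₀ _ hx.ne']
      gcongr
    · refine ae_of_all _ fun x w _ => ?_
      exact ((((hasDerivAt_id w).mul_const (x : ℂ)).neg).cexp).const_mul _
  have hGd : DifferentiableOn ℂ (fun w : ℂ => (Real.Gamma s : ℂ) * w ^ (-s : ℂ)) U := by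
    intro w hw
    refine DifferentiableAt.differentiableWithinAt ?_
    exact (differentiableAt_id.cpow_const (Or.inl hw)).const_mul _
  have hreal : ∀ r : ℝ, 0 < r → F r = (Real.Gamma s : ℂ) * (r : ℂ) ^ (-s : ℂ) := by
    intro r hr
    have h := Real.integral_rpow_mul_exp_neg_mul_Ioi hs hr
    have h2 : F r = ((∫ x in Set.Ioi (0 : ℝ), x ^ (s - 1) * Real.exp (-(r * x)) : ℝ) : ℂ) := by
      rw [← integral_complex_ofReal]
      refine integral_congr_ae (ae_of_all _ fun x => ?_)
      push_cast
      rfl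
    rw [h2, h, ← Complex.ofReal_neg, ← Complex.ofReal_cpow hr.le, ← Complex.ofReal_mul,
      Real.rpow_neg hr.le, one_div, Real.inv_rpow hr.le, mul_comm]
  have hfreq : ∃ᶠ z in nhdsWithin (1 : ℂ) {1}ᶜ,
      F z = (fun w : ℂ => (Real.Gamma s : ℂ) * w ^ (-s : ℂ)) z := by
    have ht : Tendsto (fun x : ℝ => (x : ℂ)) (nhdsWithin 1 {1}ᶜ) (nhdsWithin (1 : ℂ) {1}ᶜ) := by
      refine tendsto_nhdsWithin_iff.2 ⟨?_, ?_⟩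
      · exact (Complex.continuous_ofReal.tendsto' 1 1 (by simp)).mono_left nhdsWithin_le_nhds
      · filter_upwards [self_mem_nhdsWithin] with x hx
        simpa using hx
    refine ht.frequently (Eventually.frequently ?_)
    filter_upwards [nhdsWithin_le_nhds (lt_mem_nhds (zero_lt_one (α := ℝ)))] with x hx
    exact hreal x hx
  exact (hFd.analyticOnNhd hUo).eqOn_of_preconnected_of_frequently_eq (hGd.analyticOnNhd hUo) hUc
    (z₀ := 1) (by simp [hU]) hfreq hw

/-- Poisson summation bounds the difference between `∑ j ^ (s - 1) e ^ (-jσ)` and its integral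
uniformly in `σ` when `1 < s`. -/
theorem exists_abs_tsum_sub_le_of_one_lt {s : ℝ} (hs : 1 < s) :
    ∃ C, ∀ σ : ℝ, 0 < σ → |∑' j : ℕ, ((j + 1 : ℕ) : ℝ) ^ (s - 1) *
      Real.exp (-(σ * (j + 1 : ℕ))) - Real.Gamma s * σ ^ (-s)| ≤ C := by
  have hs0 : 0 < s := one_pos.trans hs
  have hsumm : Summable fun n : ℤ => |(n : ℝ)| ^ (-s) := Real.summable_abs_int_rpow hs
  refine ⟨Real.Gamma s * ∑' n : ℤ, |(n : ℝ)| ^ (-s), fun σ hσ => ?_⟩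
  -- Extension by zero to the negative axis; it is continuous at 0 because s > 1.
  set f : ℝ → ℂ := fun x => (((max x 0) ^ (s - 1) * Real.exp (-(σ * x)) : ℝ) : ℂ) with hf
  have hcont : Continuous f := by
    refine Complex.continuous_ofReal.comp (Continuous.mul ?_ (by fun_prop))
    exact (by fun_prop : Continuous fun x : ℝ => max x 0).rpow_const fun x => Or.inr (by linarith)
  have hneg : ∀ x ≤ 0, f x = 0 := fun x hx => by
    simp [hf, max_eq_right hx, Real.zero_rpow (sub_pos.2 hs).ne']
  have hpos : ∀ x, 0 < x → f x = ((x ^ (s - 1) : ℝ) : ℂ) * Complex.exp (-(σ * x)) := by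
    intro x hx
    simp [hf, max_eq_left hx.le]
  have hdecay : f =O[cocompact ℝ] fun x : ℝ => |x| ^ (-2 : ℝ) := by
    rw [cocompact_eq_atBot_atTop, Asymptotics.isBigO_sup]
    constructor
    · refine Asymptotics.IsBigO.of_bound 0 ?_
      filter_upwards [eventually_le_atBot 0] with x hx
      simp [hneg x hx]
    · have h1 := (isLittleO_exp_neg_mul_rpow_atTop hσ (-2 - (s - 1))).isBigO
      have h2 := (Asymptotics.isBigO_refl (fun x : ℝ => x ^ (s - 1)) atTop).mul h1
      refine (Asymptotics.IsBigO.of_norm_left (Asymptotics.IsBigO.congr' h2 ?_ ?_))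
      · filter_upwards [eventually_gt_atTop 0] with x hx
        rw [Complex.norm_real, max_eq_left hx.le, Real.norm_of_nonneg (by positivity), neg_mul]
      · filter_upwards [eventually_gt_atTop 0] with x hx
        rw [← Real.rpow_add hx, abs_of_pos hx]
        congr 1
        ring
  have hfour : ∀ n : ℤ, FourierTransform.fourier f (n : ℝ) =
      Real.Gamma s * ((σ : ℂ) + 2 * Real.pi * n * Complex.I) ^ (-s : ℂ) := by
    intro n
    rw [← integral_rpow_mul_cexp_neg_mul hs0 (by simpa using hσ),
      Real.fourier_real_eq_integral_exp_smul, ← integral_indicator measurableSet_Ioi]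
    refine integral_congr_ae (ae_of_all _ fun x => ?_)
    by_cases hx : 0 < x
    · rw [Set.indicator_of_mem (Set.mem_Ioi.2 hx)]
      simp only [hpos x hx, smul_eq_mul]
      rw [mul_left_comm, ← Complex.exp_add]
      congr 2
      push_cast
      ring
    · rw [Set.indicator_of_notMem (by simpa using hx)]
      simp [hneg x (not_lt.1 hx)]
  -- Since |σ + 2πin| ≥ |n|, the nonzero frequencies are bounded independently of σ, and summably
  -- because s > 1. The zero frequency is the main term.
  have hbd : ∀ n : ℤ, n ≠ 0 →
      ‖FourierTransform.fourier f (n : ℝ)‖ ≤ Real.Gamma s * |(n : ℝ)| ^ (-s) := by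
    intro n hn
    have hn' : 0 < |(n : ℝ)| := by positivity
    have him : |(n : ℝ)| ≤ ‖(σ : ℂ) + 2 * Real.pi * n * Complex.I‖ := by
      refine le_trans ?_ (Complex.abs_im_le_norm _)
      have : ((σ : ℂ) + 2 * Real.pi * n * Complex.I).im = 2 * Real.pi * n := by simp
      rw [this, abs_mul, abs_of_pos Real.two_pi_pos]
      exact le_mul_of_one_le_left hn'.le (by linarith [Real.pi_gt_three])
    rw [hfour, norm_mul, Complex.norm_real, Real.norm_of_nonneg (Real.Gamma_pos_of_pos hs0).le,
      ← Complex.ofReal_neg, Complex.norm_cpow_real]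
    refine mul_le_mul_of_nonneg_left ?_ (Real.Gamma_pos_of_pos hs0).le
    exact Real.rpow_le_rpow_of_nonpos hn' him (by linarith)
  have hFs : Summable fun n : ℤ => FourierTransform.fourier f (n : ℝ) := by
    refine Summable.of_norm_bounded_eventually (hsumm.mul_left (Real.Gamma s)) ?_
    filter_upwards [(Set.finite_singleton (0 : ℤ)).compl_mem_cofinite] with n hn
    exact hbd n hn
  have hpoisson := Real.tsum_eq_tsum_fourier_of_rpow_decay_of_summable hcont one_lt_two hdecay hFs 0
  have hleft : ∑' n : ℤ, f (0 + n) = ((∑' j : ℕ, ((j + 1 : ℕ) : ℝ) ^ (s - 1) *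
      Real.exp (-(σ * (j + 1 : ℕ))) : ℝ) : ℂ) := by
    have hinj : Function.Injective fun j : ℕ => ((j + 1 : ℕ) : ℤ) := fun a b h => by
      simpa using h
    rw [← hinj.tsum_eq, Complex.ofReal_tsum]
    · refine tsum_congr fun j => ?_
      rw [zero_add, Int.cast_natCast, hpos _ (by positivity)]
      push_cast
      rfl
    · intro n hn
      by_contra h
      refine hn ?_
      change f (0 + n) = 0
      rw [zero_add]
      refine hneg _ ?_
      by_contra h0
      rw [not_le, Int.cast_pos] at h0
      exact h ⟨(n - 1).toNat, by simp; omega⟩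
  have h0 : FourierTransform.fourier f ((0 : ℤ) : ℝ) = ((Real.Gamma s * σ ^ (-s) : ℝ) : ℂ) := by
    rw [hfour]
    push_cast
    rw [Complex.ofReal_cpow hσ.le]
    simp
  simp only [fourier_eval_zero, mul_one, QuotientAddGroup.mk_zero] at hpoisson
  rw [hleft, hFs.tsum_eq_add_tsum_ite 0, h0] at hpoisson
  rw [← Real.norm_eq_abs, ← Complex.norm_real, Complex.ofReal_sub, hpoisson, add_sub_cancel_left,
    ← tsum_mul_left]
  refine tsum_of_norm_bounded (hsumm.mul_left (Real.Gamma s)).hasSum fun n => ?_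
  by_cases hn : n = 0
  · rw [if_pos hn, norm_zero]
    exact mul_nonneg (Real.Gamma_pos_of_pos hs0).le (Real.rpow_nonneg (abs_nonneg _) _)
  · rw [if_neg hn]
    exact hbd n hn

theorem integrableOn_rpow_mul_exp_neg_mul {s σ : ℝ} (hs : 0 < s) (hσ : 0 < σ) :
    IntegrableOn (fun x : ℝ => x ^ (s - 1) * Real.exp (-(σ * x))) (Set.Ioi 0) := by
  have := integrableOn_rpow_mul_exp_neg_mul_rpow (s := s - 1) (p := 1) (b := σ) (by linarith)
    one_pos hσ
  simpa [neg_mul] using this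

theorem summable_rpow_mul_exp_neg_mul (s : ℝ) {σ : ℝ} (hσ : 0 < σ) :
    Summable fun j : ℕ => ((j + 1 : ℕ) : ℝ) ^ (s - 1) * Real.exp (-(σ * (j + 1 : ℕ))) := by
  have h := (summable_nat_add_iff 1).2 (Real.summable_pow_mul_exp_neg_nat_mul ⌈s - 1⌉₊ hσ)
  refine Summable.of_nonneg_of_le (fun j => by positivity) (fun j => ?_) h
  rw [neg_mul]
  gcongr
  rw [← Real.rpow_natCast]
  exact Real.rpow_le_rpow_of_exponent_le (by simp) (Nat.le_ceil _)

/-- For s ≤ 1 the summand is decreasing, so sum and integral differ by at most the integral over [0,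
1], which is at most ∫₀¹ x^{s-1} dx = 1/s. -/
theorem exists_abs_tsum_sub_le_of_le_one {s : ℝ} (hs : 0 < s) (hs1 : s ≤ 1) :
    ∃ C, ∀ σ : ℝ, 0 < σ → |∑' j : ℕ, ((j + 1 : ℕ) : ℝ) ^ (s - 1) *
      Real.exp (-(σ * (j + 1 : ℕ))) - Real.Gamma s * σ ^ (-s)| ≤ C := by
  refine ⟨s⁻¹, fun σ hσ => ?_⟩
  set f : ℝ → ℝ := fun x => x ^ (s - 1) * Real.exp (-(σ * x)) with hf
  have hanti : AntitoneOn f (Set.Ioi 0) := by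
    intro x hx y hy hxy
    have hx : 0 < x := hx
    have hy : 0 < y := hy
    refine mul_le_mul ?_ ?_ (Real.exp_pos _).le (Real.rpow_nonneg hx.le _)
    · exact Real.rpow_le_rpow_of_nonpos hx hxy (by linarith)
    · gcongr
  have hint : IntegrableOn f (Set.Ioi 0) := integrableOn_rpow_mul_exp_neg_mul hs hσ
  have hpos : ∀ x, 0 < x → 0 ≤ f x := fun x hx => by positivity
  have hG : ∫ x in Set.Ioi 0, f x = Real.Gamma s * σ ^ (-s) := by
    rw [Real.integral_rpow_mul_exp_neg_mul_Ioi hs hσ, Real.rpow_neg hσ.le, one_div,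
      Real.inv_rpow hσ.le, mul_comm]
  rw [← hG]
  have hsum : HasSum (fun j : ℕ => f (j + 1 : ℕ)) (∑' j : ℕ, f (j + 1 : ℕ)) :=
    (summable_rpow_mul_exp_neg_mul s hσ).hasSum
  have htend := hsum.tendsto_sum_nat
  have hI1 : Tendsto (fun n : ℕ => ∫ x in (0 : ℝ)..n, f x) atTop (nhds (∫ x in Set.Ioi 0, f x)) :=
    intervalIntegral_tendsto_integral_Ioi 0 hint tendsto_natCast_atTop_atTop
  have hii : ∀ a b : ℝ, 0 ≤ a → 0 ≤ b → IntervalIntegrable f volume a b := by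
    intro a b ha hb
    refine ⟨hint.mono_set fun x hx => ha.trans_lt hx.1, hint.mono_set fun x hx => hb.trans_lt hx.1⟩
  have hstep : ∀ j : ℕ, f (j + 1 : ℕ) ≤ ∫ x in (j : ℝ)..(j + 1 : ℕ), f x := by
    intro j
    have h : ∫ x in (j : ℝ)..(j + 1 : ℕ), f (j + 1 : ℕ) ≤ ∫ x in (j : ℝ)..(j + 1 : ℕ), f x := by
      refine intervalIntegral.integral_mono_on_of_le_Ioo (by simp) (by simp)
        (hii _ _ (by positivity) (by positivity)) fun x hx => ?_
      have hx0 : 0 < x := lt_of_le_of_lt (by positivity) hx.1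
      exact hanti hx0 (Set.mem_Ioi.2 (by positivity)) hx.2.le
    simpa using h
  have hstep' : ∀ j : ℕ, ∫ x in ((j + 1 : ℕ) : ℝ)..(j + 1 + 1 : ℕ), f x ≤ f (j + 1 : ℕ) := by
    intro j
    have h : ∫ x in ((j + 1 : ℕ) : ℝ)..(j + 1 + 1 : ℕ), f x ≤
        ∫ x in ((j + 1 : ℕ) : ℝ)..(j + 1 + 1 : ℕ), f (j + 1 : ℕ) := by
      refine intervalIntegral.integral_mono_on_of_le_Ioo (by simp)
        (hii _ _ (by positivity) (by positivity)) (by simp) fun x hx => ?_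
      have h0 : (0 : ℝ) < (j + 1 : ℕ) := by positivity
      exact hanti h0 (h0.trans hx.1) hx.1.le
    simpa using h
  have hfirst : ∫ x in (0 : ℝ)..1, f x ≤ s⁻¹ := by
    have h : ∫ x in (0 : ℝ)..1, f x ≤ ∫ x in (0 : ℝ)..1, x ^ (s - 1) := by
      refine intervalIntegral.integral_mono_on_of_le_Ioo zero_le_one
        (hii _ _ le_rfl zero_le_one) (intervalIntegral.intervalIntegrable_rpow' (by linarith))
        fun x hx => ?_
      refine mul_le_of_le_one_right (Real.rpow_nonneg hx.1.le _) (Real.exp_le_one_iff.2 ?_)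
      have := mul_pos hσ hx.1
      linarith
    refine h.trans_eq ?_
    rw [integral_rpow (Or.inl (by linarith))]
    simp [Real.zero_rpow hs.ne']
  have hupper : ∑' j : ℕ, f (j + 1 : ℕ) ≤ ∫ x in Set.Ioi 0, f x := by
    refine le_of_tendsto_of_tendsto' htend hI1 fun n => ?_
    refine (Finset.sum_le_sum fun j _ => hstep j).trans_eq ?_
    have := intervalIntegral.sum_integral_adjacent_intervals (f := f) (μ := volume)
      (a := fun k : ℕ => (k : ℝ)) (n := n) fun k _ => hii _ _ (by positivity) (by positivity)
    simpa using this
  have hlower : ∫ x in Set.Ioi 0, f x ≤ s⁻¹ + ∑' j : ℕ, f (j + 1 : ℕ) := by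
    refine le_of_tendsto_of_tendsto' (hI1.comp (tendsto_add_atTop_nat 1)) (htend.const_add s⁻¹)
      fun n => ?_
    have h := intervalIntegral.sum_integral_adjacent_intervals (f := f) (μ := volume)
      (a := fun k : ℕ => (k : ℝ)) (n := n + 1) fun k _ => hii _ _ (by positivity) (by positivity)
    simp only [Function.comp_apply]
    rw [Nat.cast_zero] at h
    rw [← h, Finset.sum_range_succ', add_comm]
    refine add_le_add (by simpa using hfirst) (Finset.sum_le_sum fun j _ => hstep' j)
  rw [abs_le]
  constructor <;> linarith [inv_pos.2 hs]

theorem exists_abs_tsum_sub_le {s : ℝ} (hs : 0 < s) :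
    ∃ C, ∀ σ : ℝ, 0 < σ → |∑' j : ℕ, ((j + 1 : ℕ) : ℝ) ^ (s - 1) *
      Real.exp (-(σ * (j + 1 : ℕ))) - Real.Gamma s * σ ^ (-s)| ≤ C :=
  (le_or_gt s 1).elim (exists_abs_tsum_sub_le_of_le_one hs) exists_abs_tsum_sub_le_of_one_lt

/-- Truncation costs little: beyond N, half of the damping gives e^{-Nσ/2}, and the other half
leaves a full sum at parameter σ/2, whence the factor 2^s. -/
theorem exists_abs_sum_Icc_sub_le {s : ℝ} (hs : 0 < s) :
    ∃ C, ∀ σ : ℝ, 0 < σ → ∀ N : ℕ,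
      |σ ^ s * ∑ j ∈ Finset.Icc 1 N, (j : ℝ) ^ (s - 1) * Real.exp (-(σ * j)) - Real.Gamma s| ≤
        C * (σ ^ s + Real.exp (-(N * σ / 2)) * (1 + σ ^ s)) := by
  obtain ⟨C, hC⟩ := exists_abs_tsum_sub_le hs
  have hC0 : 0 ≤ C := (abs_nonneg _).trans (hC 1 one_pos)
  have hG := Real.Gamma_pos_of_pos hs
  refine ⟨C + Real.Gamma s * 2 ^ s, fun σ hσ N => ?_⟩
  set g : ℝ → ℕ → ℝ := fun σ j => ((j + 1 : ℕ) : ℝ) ^ (s - 1) * Real.exp (-(σ * (j + 1 : ℕ)))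
    with hg
  have hsum := summable_rpow_mul_exp_neg_mul s hσ
  have hsum2 := summable_rpow_mul_exp_neg_mul s (half_pos hσ)
  have hS : ∑ j ∈ Finset.Icc 1 N, (j : ℝ) ^ (s - 1) * Real.exp (-(σ * j)) =
      ∑ j ∈ Finset.range N, g σ j := by
    rw [← Finset.Ico_add_one_right_eq_Icc, Finset.sum_Ico_eq_sum_range]
    refine Finset.sum_congr (by simp) fun j _ => ?_
    rw [add_comm 1 j]
  have htail : ∑' j, g σ (j + N) ≤ Real.exp (-(N * σ / 2)) * ∑' j, g (σ / 2) (j + N) := by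
    rw [← tsum_mul_left]
    refine Summable.tsum_le_tsum (fun j => ?_) ((summable_nat_add_iff N).2 hsum)
      (((summable_nat_add_iff N).2 hsum2).mul_left _)
    rw [hg]
    simp only
    rw [mul_left_comm, ← Real.exp_add]
    gcongr
    push_cast
    nlinarith [mul_nonneg hσ.le (by positivity : (0 : ℝ) ≤ (j : ℝ) + 1)]
  have htail2 : ∑' j, g (σ / 2) (j + N) ≤ Real.Gamma s * (σ / 2) ^ (-s) + C := by
    have h1 := hsum2.sum_add_tsum_nat_add N
    have h2 : 0 ≤ ∑ j ∈ Finset.range N, g (σ / 2) j :=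
      Finset.sum_nonneg fun j _ => by simp only [hg]; positivity
    have h3 := (abs_le.1 (hC (σ / 2) (half_pos hσ))).2
    simp only [hg] at h1 h2 ⊢
    linarith
  have htail0 : 0 ≤ ∑' j, g σ (j + N) := tsum_nonneg fun j => by simp only [hg]; positivity
  have hsplit : ∑ j ∈ Finset.range N, g σ j + ∑' j, g σ (j + N) = ∑' j, g σ j :=
    hsum.sum_add_tsum_nat_add N
  have hσs : 0 < σ ^ s := Real.rpow_pos_of_pos hσ s
  have hcancel : σ ^ s * σ ^ (-s) = 1 := by
    rw [← Real.rpow_add hσ]; simp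
  have hcancel2 : σ ^ s * (σ / 2) ^ (-s) = 2 ^ s := by
    rw [Real.div_rpow hσ.le zero_le_two, mul_div_assoc', hcancel, Real.rpow_neg zero_le_two]
    simp
  set E := Real.exp (-(N * σ / 2)) with hE
  have hE0 : 0 < E := Real.exp_pos _
  have hmain : σ ^ s * ∑ j ∈ Finset.range N, g σ j - Real.Gamma s =
      σ ^ s * (∑' j, g σ j - Real.Gamma s * σ ^ (-s)) - σ ^ s * ∑' j, g σ (j + N) := by
    rw [← hsplit]
    linear_combination (Real.Gamma s) * hcancel
  rw [hS, hmain]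
  have h1 : |σ ^ s * (∑' j, g σ j - Real.Gamma s * σ ^ (-s))| ≤ σ ^ s * C := by
    rw [abs_mul, abs_of_pos hσs]
    exact mul_le_mul_of_nonneg_left (hC σ hσ) hσs.le
  have h2 : |σ ^ s * ∑' j, g σ (j + N)| ≤ E * (Real.Gamma s * 2 ^ s + σ ^ s * C) := by
    rw [abs_of_nonneg (mul_nonneg hσs.le htail0)]
    calc σ ^ s * ∑' j, g σ (j + N) ≤ σ ^ s * (E * (Real.Gamma s * (σ / 2) ^ (-s) + C)) := by
          gcongr
          exact htail.trans (mul_le_mul_of_nonneg_left htail2 hE0.le)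
      _ = E * (Real.Gamma s * 2 ^ s + σ ^ s * C) := by rw [← hcancel2]; ring
  refine (abs_sub _ _).trans ((add_le_add h1 h2).trans ?_)
  have h3 : 0 ≤ Real.Gamma s * 2 ^ s := by positivity
  have h4 : 0 ≤ E * σ ^ s := by positivity
  nlinarith [mul_nonneg hE0.le hC0, mul_nonneg h4 h3, mul_nonneg hσs.le h3]

/-- Along `σ → 0` with `N` of order `σ ^ (-(p + 1))`, the truncated power sums approach their
Gamma integrals with an error that is negligible compared to `σ ^ (p / 2)`. -/
theorem tendsto_scaled_sum_sub {p c s : ℝ} (hp : 0 < p) (hc : 0 < c) (hps : p / 2 < s)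
    {σ : ℕ → ℝ} (hσ : ∀ᶠ N in atTop, 0 < σ N) (hσ0 : Tendsto σ atTop (nhds 0))
    (hN : ∀ᶠ N : ℕ in atTop, (N : ℝ) = c * σ N ^ (-(p + 1))) :
    Tendsto (fun N : ℕ => (σ N ^ (p / 2))⁻¹ * (σ N ^ s *
      ∑ j ∈ Finset.Icc 1 N, (j : ℝ) ^ (s - 1) * Real.exp (-(σ N * j)) - Real.Gamma s))
      atTop (nhds 0) := by
  have hs : 0 < s := by linarith
  obtain ⟨C, hC⟩ := exists_abs_sum_Icc_sub_le hs
  have hσ' : Tendsto σ atTop (nhdsWithin 0 (Set.Ioi 0)) := tendsto_nhdsWithin_iff.2 ⟨hσ0, hσ⟩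
  have hpow : ∀ a : ℝ, 0 < a → Tendsto (fun N => σ N ^ a) atTop (nhds 0) := fun a ha => by
    have := hσ0.rpow_const (p := a) (Or.inr ha.le)
    rwa [Real.zero_rpow ha.ne'] at this
  have hinv : Tendsto (fun N => σ N ^ (-p)) atTop atTop := by
    have := (tendsto_rpow_neg_nhdsGT_zero (neg_lt_zero.2 hp)).comp hσ'
    exact this
  have hexp : Tendsto (fun N => (σ N ^ (p / 2))⁻¹ * Real.exp (-(c / 2) * σ N ^ (-p)))
      atTop (nhds 0) := by
    have h := ((tendsto_rpow_mul_exp_neg_mul_atTop_nhds_zero (1 / 2) (c / 2) (half_pos hc)).comp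
      hinv)
    refine h.congr' ?_
    filter_upwards [hσ] with N hN
    simp only [Function.comp_apply]
    rw [← Real.rpow_mul hN.le, ← Real.rpow_neg hN.le]
    congr 2
    ring
  -- The O(1) error of the full sum becomes σ^{s-p/2}, which is where s > p/2 enters; the truncation
  -- error is exponentially small in σ^{-p}, as Nσ = c σ^{-p}.
  have hbound : Tendsto (fun N => C * (σ N ^ (s - p / 2) +
      (σ N ^ (p / 2))⁻¹ * Real.exp (-(c / 2) * σ N ^ (-p)) * (1 + σ N ^ s))) atTop (nhds 0) := by
    have := ((hpow _ (sub_pos.2 hps)).add (hexp.mul ((hpow s hs).const_add 1))).const_mul C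
    simpa using this
  refine squeeze_zero_norm' ?_ hbound
  filter_upwards [hσ, hN] with N h1 h2
  have h3 : (N : ℝ) * σ N / 2 = c / 2 * σ N ^ (-p) := by
    have : σ N ^ (-p) = σ N ^ (-(p + 1)) * σ N := by
      rw [← Real.rpow_add_one h1.ne']; congr 1; ring
    rw [h2, this]; ring
  have h4 := hC (σ N) h1 N
  rw [h3] at h4
  have h5 : 0 < σ N ^ (p / 2) := Real.rpow_pos_of_pos h1 _
  rw [Real.norm_eq_abs, abs_mul, abs_of_pos (inv_pos.2 h5), Real.rpow_sub h1, neg_mul]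
  refine (mul_le_mul_of_nonneg_left h4 (inv_pos.2 h5).le).trans_eq ?_
  field_simp

theorem tendsto_scaled_sum {p c s : ℝ} (hp : 0 < p) (hc : 0 < c) (hps : p / 2 < s)
    {σ : ℕ → ℝ} (hσ : ∀ᶠ N in atTop, 0 < σ N) (hσ0 : Tendsto σ atTop (nhds 0))
    (hN : ∀ᶠ N : ℕ in atTop, (N : ℝ) = c * σ N ^ (-(p + 1))) :
    Tendsto (fun N : ℕ => σ N ^ s *
      ∑ j ∈ Finset.Icc 1 N, (j : ℝ) ^ (s - 1) * Real.exp (-(σ N * j)))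
      atTop (nhds (Real.Gamma s)) := by
  have h1 := tendsto_scaled_sum_sub hp hc hps hσ hσ0 hN
  have h2 : Tendsto (fun N => σ N ^ (p / 2)) atTop (nhds 0) := by
    have := hσ0.rpow_const (p := p / 2) (Or.inr (half_pos hp).le)
    rwa [Real.zero_rpow (half_pos hp).ne'] at this
  have h3 := (h2.mul h1).add_const (Real.Gamma s)
  rw [zero_mul, zero_add] at h3
  refine h3.congr' ?_
  filter_upwards [hσ] with N hN
  rw [mul_inv_cancel_left₀ (Real.rpow_pos_of_pos hN _).ne', sub_add_cancel]

/-! ### Local expansion of the characteristic function -/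

theorem norm_cexp_mul_I_sub_le (w : ℝ) :
    ‖Complex.exp (w * Complex.I) - 1 - w * Complex.I + w ^ 2 / 2‖ ≤ 4 * |w| ^ 3 := by
  have hw : ‖(w : ℂ) * Complex.I‖ = |w| := by simp
  rcases le_total |w| 1 with h | h
  · have h1 := Complex.exp_bound (x := w * Complex.I) (hw.trans_le h) (n := 3) (by norm_num)
    have h2 : ∑ m ∈ Finset.range 3, ((w : ℂ) * Complex.I) ^ m / (m ! : ℂ) =
        1 + w * Complex.I - w ^ 2 / 2 := by
      simp [Finset.sum_range_succ, Nat.factorial, mul_pow]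
      ring
    rw [h2, hw] at h1
    have h3 : Complex.exp (w * Complex.I) - 1 - w * Complex.I + w ^ 2 / 2 =
        Complex.exp (w * Complex.I) - (1 + w * Complex.I - w ^ 2 / 2) := by ring
    rw [h3]
    refine h1.trans ?_
    rw [mul_comm]
    gcongr
    norm_num [Nat.factorial]
  · calc ‖Complex.exp (w * Complex.I) - 1 - w * Complex.I + w ^ 2 / 2‖
        ≤ ‖Complex.exp (w * Complex.I)‖ + ‖(1 : ℂ)‖ + ‖(w : ℂ) * Complex.I‖ +
          ‖(w : ℂ) ^ 2 / 2‖ :=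
          (norm_add_le _ _).trans (add_le_add_left ((norm_sub_le _ _).trans
            (add_le_add_left (norm_sub_le _ _) _)) _)
      _ = 2 + |w| + |w| ^ 2 / 2 := by
          rw [Complex.norm_exp_ofReal_mul_I, hw]
          simp
          norm_num
      _ ≤ 4 * |w| ^ 3 := by
          have h2 : |w| ≤ |w| ^ 3 := by nlinarith [mul_nonneg (sub_nonneg.2 h) (sub_nonneg.2 h)]
          nlinarith [mul_nonneg (sub_nonneg.2 h) (sub_nonneg.2 h)]

/-- The logarithm of the characteristic function, centred at `(m, M)`, of `(∑ X_j, ∑ j X_j)` for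
independent Poisson variables `X_j` of mean `l j`, `1 ≤ j ≤ N`. -/
noncomputable def logChar (l : ℕ → ℝ) (N : ℕ) (m M u θ : ℝ) : ℂ :=
  ∑ j ∈ Finset.Icc 1 N, l j * (Complex.exp ((u + j * θ : ℝ) * Complex.I) - 1) -
    ((M * θ + m * u : ℝ) : ℂ) * Complex.I

/-- The `k`-th power moment of the intensities `l`. -/
noncomputable def moment (l : ℕ → ℝ) (N k : ℕ) : ℝ := ∑ j ∈ Finset.Icc 1 N, l j * (j : ℝ) ^ k

/-- Second-order Taylor expansion in each phase u + jθ. The factor 16 is the Taylor constant 4 times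
the 4 in (a + b)³ ≤ 4(a³ + b³). -/
theorem norm_logChar_sub_le {l : ℕ → ℝ} (hl : ∀ j, 0 ≤ l j) (N : ℕ) (m M u θ : ℝ) :
    ‖logChar l N m M u θ -
      ((u * (moment l N 0 - m) + θ * (moment l N 1 - M) : ℝ) * Complex.I -
        ((u ^ 2 * moment l N 0 + 2 * u * θ * moment l N 1 + θ ^ 2 * moment l N 2 : ℝ) : ℂ) / 2)‖ ≤
      16 * (|u| ^ 3 * moment l N 0 + |θ| ^ 3 * moment l N 3) := by
  have h : logChar l N m M u θ -
      ((u * (moment l N 0 - m) + θ * (moment l N 1 - M) : ℝ) * Complex.I -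
        ((u ^ 2 * moment l N 0 + 2 * u * θ * moment l N 1 + θ ^ 2 * moment l N 2 : ℝ) : ℂ) / 2) =
      ∑ j ∈ Finset.Icc 1 N, l j * (Complex.exp ((u + j * θ : ℝ) * Complex.I) - 1 -
        (u + j * θ : ℝ) * Complex.I + ((u + j * θ : ℝ) : ℂ) ^ 2 / 2) := by
    have h1 : ∀ j : ℕ, (l j : ℂ) * (Complex.exp ((u + j * θ : ℝ) * Complex.I) - 1 -
        (u + j * θ : ℝ) * Complex.I + ((u + j * θ : ℝ) : ℂ) ^ 2 / 2) =
        l j * (Complex.exp ((u + j * θ : ℝ) * Complex.I) - 1) -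
        (u * Complex.I - u ^ 2 / 2) * ((l j * (j : ℝ) ^ 0 : ℝ) : ℂ)
        - (θ * Complex.I - u * θ) * ((l j * (j : ℝ) ^ 1 : ℝ) : ℂ)
        + (θ ^ 2 / 2 : ℂ) * ((l j * (j : ℝ) ^ 2 : ℝ) : ℂ) := fun j => by
      push_cast; ring
    simp_rw [h1]
    rw [Finset.sum_add_distrib, Finset.sum_sub_distrib, Finset.sum_sub_distrib, ← Finset.mul_sum,
      ← Finset.mul_sum, ← Finset.mul_sum, ← Complex.ofReal_sum, ← Complex.ofReal_sum,
      ← Complex.ofReal_sum]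
    change _ = _ - _ * (moment l N 0 : ℂ) - _ * (moment l N 1 : ℂ) + _ * (moment l N 2 : ℂ)
    rw [logChar]
    push_cast
    ring
  rw [h]
  refine (norm_sum_le _ _).trans ?_
  have h2 : 16 * (|u| ^ 3 * moment l N 0 + |θ| ^ 3 * moment l N 3) =
      ∑ j ∈ Finset.Icc 1 N, l j * (16 * (|u| ^ 3 + (j : ℝ) ^ 3 * |θ| ^ 3)) := by
    simp only [moment]
    rw [Finset.mul_sum, Finset.mul_sum, ← Finset.sum_add_distrib, Finset.mul_sum]
    exact Finset.sum_congr rfl fun j _ => by ring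
  rw [h2]
  refine Finset.sum_le_sum fun j _ => ?_
  rw [norm_mul, Complex.norm_real, Real.norm_of_nonneg (hl j)]
  refine mul_le_mul_of_nonneg_left ((norm_cexp_mul_I_sub_le _).trans ?_) (hl j)
  have h3 : |u + j * θ| ≤ |u| + j * |θ| :=
    (abs_add_le _ _).trans_eq (by rw [abs_mul, Nat.abs_cast])
  have h4 : (|u| + j * |θ|) ^ 3 ≤ 2 ^ (3 - 1) * (|u| ^ 3 + (j * |θ|) ^ 3) :=
    add_pow_le (abs_nonneg u) (by positivity) 3
  have h5 : |u + j * θ| ^ 3 ≤ (|u| + j * |θ|) ^ 3 := by gcongr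
  rw [mul_pow] at h4
  norm_num at h4
  linarith

/-- The local Gaussian limit of the characteristic function in the scaling `u = τ ε`,
`θ = y σ ε`. -/
theorem tendsto_logChar {l : ℕ → ℕ → ℝ} (hl : ∀ N j, 0 ≤ l N j) {σ ε : ℕ → ℝ}
    (hσ : ∀ᶠ N in atTop, 0 < σ N) (hε : ∀ᶠ N in atTop, 0 < ε N)
    (hε0 : Tendsto ε atTop (nhds 0)) {G : ℕ → ℝ}
    (hG : ∀ k, Tendsto (fun N => ε N ^ 2 * σ N ^ k * moment (l N) N k) atTop (nhds (G k)))
    (hG' : ∀ k ≤ 1, Tendsto (fun N => (ε N)⁻¹ * (ε N ^ 2 * σ N ^ k * moment (l N) N k - G k))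
      atTop (nhds 0)) (τ y : ℝ) :
    Tendsto (fun N => logChar (l N) N (G 0 / ε N ^ 2) (G 1 / (ε N ^ 2 * σ N)) (τ * ε N)
      (y * (σ N * ε N))) atTop
      (nhds ((-(τ ^ 2 * G 0 + 2 * τ * y * G 1 + y ^ 2 * G 2) / 2 : ℝ) : ℂ)) := by
  -- After rescaling, the linear term carries 1/ε times the error of the rescaled means; this is why
  -- `hG'` is needed for k = 0, 1 on top of mere convergence.
  have hmain : Tendsto (fun N =>
      (((τ * ((ε N)⁻¹ * (ε N ^ 2 * σ N ^ 0 * moment (l N) N 0 - G 0)) +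
        y * ((ε N)⁻¹ * (ε N ^ 2 * σ N ^ 1 * moment (l N) N 1 - G 1)) : ℝ) : ℂ) * Complex.I -
        ((τ ^ 2 * (ε N ^ 2 * σ N ^ 0 * moment (l N) N 0) +
          2 * τ * y * (ε N ^ 2 * σ N ^ 1 * moment (l N) N 1) +
          y ^ 2 * (ε N ^ 2 * σ N ^ 2 * moment (l N) N 2) : ℝ) : ℂ) / 2)) atTop
      (nhds ((-(τ ^ 2 * G 0 + 2 * τ * y * G 1 + y ^ 2 * G 2) / 2 : ℝ) : ℂ)) := by
    have h1 := ((hG' 0 zero_le_one).const_mul τ).add ((hG' 1 le_rfl).const_mul y)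
    have h2 := (((hG 0).const_mul (τ ^ 2)).add ((hG 1).const_mul (2 * τ * y))).add
      ((hG 2).const_mul (y ^ 2))
    have h3 := ((Complex.continuous_ofReal.tendsto _).comp h1).mul_const Complex.I
    have h4 := ((Complex.continuous_ofReal.tendsto _).comp h2).div_const 2
    have h5 := h3.sub h4
    have h6 : ((τ * 0 + y * 0 : ℝ) : ℂ) * Complex.I -
        ((τ ^ 2 * G 0 + 2 * τ * y * G 1 + y ^ 2 * G 2 : ℝ) : ℂ) / 2 =
        ((-(τ ^ 2 * G 0 + 2 * τ * y * G 1 + y ^ 2 * G 2) / 2 : ℝ) : ℂ) := by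
      push_cast; ring
    rw [h6] at h5
    exact h5
  have herr : Tendsto (fun N => 16 * (|τ| ^ 3 * (ε N * (ε N ^ 2 * σ N ^ 0 * moment (l N) N 0)) +
      |y| ^ 3 * (ε N * (ε N ^ 2 * σ N ^ 3 * moment (l N) N 3)))) atTop (nhds 0) := by
    have := ((((hε0.mul (hG 0)).const_mul (|τ| ^ 3)).add
      ((hε0.mul (hG 3)).const_mul (|y| ^ 3))).const_mul 16)
    simpa using this
  have hdiff := squeeze_zero_norm' (f := fun N =>
      logChar (l N) N (G 0 / ε N ^ 2) (G 1 / (ε N ^ 2 * σ N)) (τ * ε N) (y * (σ N * ε N)) -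
      (((τ * ((ε N)⁻¹ * (ε N ^ 2 * σ N ^ 0 * moment (l N) N 0 - G 0)) +
        y * ((ε N)⁻¹ * (ε N ^ 2 * σ N ^ 1 * moment (l N) N 1 - G 1)) : ℝ) : ℂ) * Complex.I -
        ((τ ^ 2 * (ε N ^ 2 * σ N ^ 0 * moment (l N) N 0) +
          2 * τ * y * (ε N ^ 2 * σ N ^ 1 * moment (l N) N 1) +
          y ^ 2 * (ε N ^ 2 * σ N ^ 2 * moment (l N) N 2) : ℝ) : ℂ) / 2)) ?_ herr
  · simpa using hdiff.add hmain
  · filter_upwards [hσ, hε] with N h1 h2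
    have h := norm_logChar_sub_le (hl N) N (G 0 / ε N ^ 2) (G 1 / (ε N ^ 2 * σ N)) (τ * ε N)
      (y * (σ N * ε N))
    have e1 : τ * ((ε N)⁻¹ * (ε N ^ 2 * σ N ^ 0 * moment (l N) N 0 - G 0)) +
        y * ((ε N)⁻¹ * (ε N ^ 2 * σ N ^ 1 * moment (l N) N 1 - G 1)) =
        τ * ε N * (moment (l N) N 0 - G 0 / ε N ^ 2) +
          y * (σ N * ε N) * (moment (l N) N 1 - G 1 / (ε N ^ 2 * σ N)) := by
      field_simp
    have e2 : τ ^ 2 * (ε N ^ 2 * σ N ^ 0 * moment (l N) N 0) +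
          2 * τ * y * (ε N ^ 2 * σ N ^ 1 * moment (l N) N 1) +
          y ^ 2 * (ε N ^ 2 * σ N ^ 2 * moment (l N) N 2) =
        (τ * ε N) ^ 2 * moment (l N) N 0 + 2 * (τ * ε N) * (y * (σ N * ε N)) * moment (l N) N 1 +
          (y * (σ N * ε N)) ^ 2 * moment (l N) N 2 := by ring
    rw [e1, e2]
    refine h.trans_eq ?_
    rw [abs_mul, abs_mul, abs_of_pos h2, abs_of_pos (mul_pos h1 h2)]
    ring

/-! ### Decay of the characteristic function away from zero -/

/-- Since 2(1 - cos a) = |1 - e^{ia}|², this is |z - w|² ≤ 2(|z|² + |w|²). It turns a phase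
difference into a lower bound for the two phases. -/
theorem one_sub_cos_sub_le (a b : ℝ) :
    1 - Real.cos (b - a) ≤ 2 * ((1 - Real.cos a) + (1 - Real.cos b)) := by
  rw [Real.cos_sub]
  have ha := Real.sin_sq_add_cos_sq a
  have hb := Real.sin_sq_add_cos_sq b
  nlinarith [sq_nonneg (Real.sin a + Real.sin b), sq_nonneg (Real.cos a + Real.cos b - 2)]

/-- Take m = min(A, ⌊π/|θ|⌋): either Aθ does not wrap around the circle, or the last multiple before
π already exceeds π/2 > 1. -/
theorem exists_shift {σ θ : ℝ} (hσ : 0 < σ) (hθ : |θ| ≤ Real.pi) {A : ℕ} (hA : 1 ≤ A * σ) :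
    ∃ m ≤ A, |m * θ| ≤ Real.pi ∧ min 1 (|θ| / σ) ≤ |m * θ| := by
  rcases eq_or_ne θ 0 with rfl | h0
  · exact ⟨0, by simp, by simp [Real.pi_pos.le], by simp⟩
  have hθ0 : 0 < |θ| := abs_pos.2 h0
  have hπ := Real.pi_gt_three
  by_cases h : A ≤ ⌊Real.pi / |θ|⌋₊
  · refine ⟨A, le_rfl, ?_, (min_le_right _ _).trans ?_⟩
    · rw [abs_mul, Nat.abs_cast, ← le_div_iff₀ hθ0]
      exact (Nat.le_floor_iff (by positivity)).1 h
    · rw [abs_mul, Nat.abs_cast, div_le_iff₀ hσ]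
      nlinarith
  · have hle : (⌊Real.pi / |θ|⌋₊ : ℝ) ≤ Real.pi / |θ| := Nat.floor_le (by positivity)
    have hlt : Real.pi / |θ| < ⌊Real.pi / |θ|⌋₊ + 1 := Nat.lt_floor_add_one _
    have hone : (1 : ℝ) ≤ ⌊Real.pi / |θ|⌋₊ := by
      exact_mod_cast Nat.le_floor (by rw [Nat.cast_one, le_div_iff₀ hθ0]; linarith)
    rw [le_div_iff₀ hθ0] at hle
    rw [div_lt_iff₀ hθ0] at hlt
    refine ⟨⌊Real.pi / |θ|⌋₊, (not_le.1 h).le, ?_, (min_le_left _ _).trans ?_⟩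
    · rwa [abs_mul, Nat.abs_cast]
    · rw [abs_mul, Nat.abs_cast]
      nlinarith

/-- A single phase u + jθ may be near a multiple of 2π, but not those of both j and j + m when mθ is
away from 0. Summing over such pairs gives a bound uniform in u. -/
theorem min_sq_le_sum_one_sub_cos {l : ℕ → ℝ} (hl : ∀ j, 0 ≤ l j) {σ κ : ℝ} (hσ : 0 < σ)
    (hσ1 : σ ≤ 1) (hκ : 0 ≤ κ) (hlκ : ∀ j : ℕ, 1 ≤ j * σ → j * σ ≤ 6 → κ ≤ l j) {N : ℕ}
    (hN : 6 / σ ≤ N) {θ : ℝ} (hθ : |θ| ≤ Real.pi) (u : ℝ) :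
    κ / (2 * Real.pi ^ 2 * σ) * min 1 (|θ| / σ) ^ 2 ≤
      ∑ j ∈ Finset.Icc 1 N, l j * (1 - Real.cos (u + j * θ)) := by
  -- With 1 ≤ Aσ ≤ 2, all indices in [A, 3A) lie in the window 1 ≤ jσ ≤ 6; the block [A, 2A) and its
  -- shift by m ≤ A both fit inside.
  set A : ℕ := ⌈1 / σ⌉₊ with hA
  have hA1 : 1 / σ ≤ A := Nat.le_ceil _
  have hA2 : (A : ℝ) < 1 / σ + 1 := Nat.ceil_lt_add_one (by positivity)
  have hAσ : 1 ≤ A * σ := by rwa [div_le_iff₀ hσ] at hA1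
  have hAσ2 : A * σ ≤ 2 := by
    have := mul_lt_mul_of_pos_right hA2 hσ
    rw [add_mul, one_div, inv_mul_cancel₀ hσ.ne'] at this
    linarith
  have hA0 : 1 ≤ A := by
    by_contra h
    rw [show A = 0 by omega] at hAσ
    norm_num at hAσ
  obtain ⟨m, hmA, hmπ, hmin⟩ := exists_shift hσ hθ hAσ
  have hcos : 2 / Real.pi ^ 2 * min 1 (|θ| / σ) ^ 2 ≤ 1 - Real.cos (m * θ) := by
    have h1 := Real.cos_le_one_sub_mul_cos_sq hmπ
    have h2 : min 1 (|θ| / σ) ^ 2 ≤ (m * θ) ^ 2 := by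
      rw [← sq_abs (m * θ)]
      gcongr
    have h3 : 2 / Real.pi ^ 2 * min 1 (|θ| / σ) ^ 2 ≤ 2 / Real.pi ^ 2 * (m * θ) ^ 2 := by gcongr
    linarith
  set g : ℕ → ℝ := fun j => 1 - Real.cos (u + j * θ) with hg
  have hg0 : ∀ j, 0 ≤ g j := fun j => sub_nonneg.2 (Real.cos_le_one _)
  have hpair : ∀ j, (1 - Real.cos (m * θ)) / 2 ≤ g j + g (j + m) := fun j => by
    have h := one_sub_cos_sub_le (u + j * θ) (u + (j + m : ℕ) * θ)
    rw [show u + (j + m : ℕ) * θ - (u + j * θ) = m * θ by push_cast; ring] at h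
    simp only [hg]
    linarith
  have hblock1 : ∑ j ∈ Finset.Ico A (2 * A), g j ≤ ∑ j ∈ Finset.Ico A (3 * A), g j :=
    Finset.sum_le_sum_of_subset_of_nonneg
      (Finset.Ico_subset_Ico le_rfl (by omega)) fun j _ _ => hg0 j
  have hblock2 : ∑ j ∈ Finset.Ico A (2 * A), g (j + m) ≤ ∑ j ∈ Finset.Ico A (3 * A), g j := by
    rw [Finset.sum_Ico_add']
    exact Finset.sum_le_sum_of_subset_of_nonneg
      (Finset.Ico_subset_Ico (by omega) (by omega)) fun j _ _ => hg0 j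
  have hblock : (A : ℝ) * ((1 - Real.cos (m * θ)) / 2) ≤
      2 * ∑ j ∈ Finset.Ico A (3 * A), g j := by
    have h := Finset.sum_le_sum fun j (_ : j ∈ Finset.Ico A (2 * A)) => hpair j
    rw [Finset.sum_const, Nat.card_Ico, nsmul_eq_mul, Finset.sum_add_distrib,
      show 2 * A - A = A by omega] at h
    linarith
  have hsub : Finset.Ico A (3 * A) ⊆ Finset.Icc 1 N := by
    intro j hj
    rw [Finset.mem_Ico] at hj
    refine Finset.mem_Icc.2 ⟨by omega, ?_⟩
    have h1 : (j : ℝ) ≤ 3 * A := by exact_mod_cast hj.2.le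
    have h2 : (3 * A : ℝ) ≤ 6 / σ := by
      rw [le_div_iff₀ hσ]; linarith
    exact_mod_cast h1.trans (h2.trans hN)
  calc κ / (2 * Real.pi ^ 2 * σ) * min 1 (|θ| / σ) ^ 2
      = κ * (1 / σ * (2 / Real.pi ^ 2 * min 1 (|θ| / σ) ^ 2 / 2) / 2) := by
        field_simp
    _ ≤ κ * (A * ((1 - Real.cos (m * θ)) / 2) / 2) := by gcongr
    _ ≤ κ * ∑ j ∈ Finset.Ico A (3 * A), g j := by
        gcongr
        linarith
    _ ≤ ∑ j ∈ Finset.Ico A (3 * A), l j * g j := by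
        rw [Finset.mul_sum]
        refine Finset.sum_le_sum fun j hj => mul_le_mul_of_nonneg_right (hlκ j ?_ ?_) (hg0 j)
        · refine hAσ.trans (mul_le_mul_of_nonneg_right ?_ hσ.le)
          exact_mod_cast (Finset.mem_Ico.1 hj).1
        · have h1 : (j : ℝ) ≤ 3 * A := by exact_mod_cast (Finset.mem_Ico.1 hj).2.le
          nlinarith
    _ ≤ ∑ j ∈ Finset.Icc 1 N, l j * (1 - Real.cos (u + j * θ)) :=
        Finset.sum_le_sum_of_subset_of_nonneg hsub fun j _ _ => mul_nonneg (hl j) (hg0 j)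

/-! ### Conditioning the Poisson model -/

theorem norm_exp_logChar (l : ℕ → ℝ) (N : ℕ) (m M u θ : ℝ) :
    ‖Complex.exp (logChar l N m M u θ)‖ =
      Real.exp (-∑ j ∈ Finset.Icc 1 N, l j * (1 - Real.cos (u + j * θ))) := by
  rw [Complex.norm_exp, logChar, Complex.sub_re, Complex.re_sum, Complex.re_ofReal_mul,
    Complex.I_re, mul_zero, sub_zero, ← Finset.sum_neg_distrib]
  congr 1
  refine Finset.sum_congr rfl fun j _ => ?_
  rw [Complex.re_ofReal_mul, Complex.sub_re, Complex.exp_ofReal_mul_I_re, Complex.one_re]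
  ring

/-- The integral over θ selects the event ∑ j X_j = N. On it the tilt contributes the same factor
r^N to every partition, so it cancels in quotients. -/
theorem integral_exp_logChar {a l : ℕ → ℝ} {r : ℝ} {N : ℕ}
    (hl : ∀ j ∈ Finset.Icc 1 N, l j = a j * r ^ j) (m u : ℝ) :
    ∫ θ in (-Real.pi)..Real.pi, Complex.exp (logChar l N m N u θ) =
      (2 * Real.pi * Real.exp (-∑ j ∈ Finset.Icc 1 N, l j) * r ^ N : ℝ) *
        ∑ η : Nat.Partition N, (weight a η : ℂ) *
          Complex.exp ((u * (numGroups η - m) : ℝ) * Complex.I) := by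
  have h1 : ∀ θ : ℝ, Complex.exp (logChar l N m N u θ) =
      (Real.exp (-∑ j ∈ Finset.Icc 1 N, l j) : ℂ) * Complex.exp (-(u * m : ℝ) * Complex.I) *
        (Complex.exp (∑ j ∈ Finset.Icc 1 N, (l j * Complex.exp (u * Complex.I)) *
          Complex.exp (θ * Complex.I) ^ j) * Complex.exp (-(N * θ : ℝ) * Complex.I)) := by
    intro θ
    have h2 : ∀ j : ℕ, (l j : ℂ) * (Complex.exp ((u + j * θ : ℝ) * Complex.I) - 1) =
        (l j * Complex.exp (u * Complex.I)) * Complex.exp (θ * Complex.I) ^ j - l j := by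
      intro j
      rw [← Complex.exp_nat_mul, mul_assoc, ← Complex.exp_add, mul_sub, mul_one]
      congr 3
      push_cast
      ring
    rw [logChar]
    simp_rw [h2]
    rw [Finset.sum_sub_distrib, Complex.ofReal_exp, ← Complex.exp_add, ← Complex.exp_add,
      ← Complex.exp_add]
    congr 1
    push_cast
    ring
  simp_rw [h1]
  rw [intervalIntegral.integral_const_mul, integral_exp_sum_mul_exp, Finset.mul_sum,
    Finset.mul_sum, Finset.mul_sum]
  refine Finset.sum_congr rfl fun η _ => ?_
  have h3 : ∏ j ∈ Finset.Icc 1 N, ((l j : ℂ) * Complex.exp (u * Complex.I)) ^ groupCount η j /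
      ((groupCount η j)! : ℂ) =
      (weight a η : ℂ) * (r : ℂ) ^ N * Complex.exp (u * Complex.I) ^ numGroups η := by
    have h4 : (r : ℂ) ^ N = ∏ j ∈ Finset.Icc 1 N, ((r : ℂ) ^ j) ^ groupCount η j := by
      simp_rw [← pow_mul]
      rw [Finset.prod_pow_eq_pow_sum, sum_mul_groupCount]
    rw [numGroups, ← Finset.prod_pow_eq_pow_sum, h4, weight, Complex.ofReal_prod,
      ← Finset.prod_mul_distrib, ← Finset.prod_mul_distrib]
    refine Finset.prod_congr rfl fun j hj => ?_
    rw [hl j hj]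
    push_cast
    ring
  have h5 : Complex.exp ((u * (numGroups η - m) : ℝ) * Complex.I) =
      Complex.exp (-(u * m : ℝ) * Complex.I) * Complex.exp (u * Complex.I) ^ numGroups η := by
    rw [← Complex.exp_nat_mul, ← Complex.exp_add]
    congr 1
    push_cast
    ring
  rw [h3, h5]
  push_cast
  ring

theorem charFun_map_numGroups {a l : ℕ → ℝ} (ha : ∀ k, 1 ≤ k → 0 < a k) {r : ℝ} (hr : 0 < r)
    {N : ℕ} (hl : ∀ j ∈ Finset.Icc 1 N, l j = a j * r ^ j) (m s t : ℝ) :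
    charFun ((equilibriumMeasure a ha N).map fun η => ((numGroups η : ℝ) - m) / s) t =
      (∫ θ in (-Real.pi)..Real.pi, Complex.exp (logChar l N m N (t / s) θ)) /
        ∫ θ in (-Real.pi)..Real.pi, Complex.exp (logChar l N m N 0 θ) := by
  have hc := partitionFunction_pos ha N
  have hC : ((2 * Real.pi * Real.exp (-∑ j ∈ Finset.Icc 1 N, l j) * r ^ N : ℝ) : ℂ) ≠ 0 := by
    exact_mod_cast (by positivity :
      0 < 2 * Real.pi * Real.exp (-∑ j ∈ Finset.Icc 1 N, l j) * r ^ N).ne'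
  rw [integral_exp_logChar hl, integral_exp_logChar hl, mul_div_mul_left _ _ hC,
    charFun_apply_real, integral_map (measurable_from_top.aemeasurable)
      (Continuous.aestronglyMeasurable (by fun_prop)),
    equilibriumMeasure, PMF.integral_eq_sum, Finset.sum_div]
  refine Finset.sum_congr rfl fun η _ => ?_
  have hden : ∑ η : Nat.Partition N, (weight a η : ℂ) *
      Complex.exp ((0 * (numGroups η - m) : ℝ) * Complex.I) = (partitionFunction a N : ℂ) := by
    simp [partitionFunction]
  rw [hden, equilibriumPMF, PMF.ofFintype_apply,
    ENNReal.toReal_ofReal (div_pos (weight_pos ha η) hc).le, Complex.real_smul]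
  push_cast
  rw [div_mul_eq_mul_div]
  congr 3
  ring

/-! ### An integrable majorant -/

theorem integrable_exp_neg_mul_abs_rpow {c a : ℝ} (hc : 0 < c) (ha : 0 < a) :
    Integrable fun y : ℝ => Real.exp (-(c * |y| ^ a)) := by
  have h : IntegrableOn (fun y : ℝ => Real.exp (-(c * |y| ^ a))) (Set.Ioi 0) := by
    have := integrableOn_rpow_mul_exp_neg_mul_rpow (s := 0) (by norm_num) ha hc
    refine this.congr_fun (fun y hy => ?_) measurableSet_Ioi
    have hy : 0 < y := hy
    simp [abs_of_pos hy]
  have h' : IntegrableOn (fun y : ℝ => Real.exp (-(c * |y| ^ a))) (Set.Iio 0) := by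
    have := IntegrableOn.comp_neg_Iio (c := (0 : ℝ)) (by rwa [← neg_zero] at h)
    simpa only [abs_neg] using this
  rw [← integrableOn_univ, ← Set.Iic_union_Ioi (a := (0 : ℝ))]
  exact ((integrableOn_Iic_iff_integrableOn_Iio).2 h').union h

/-- The elementary inequality behind the integrable majorant of the rescaled characteristic
function. -/
theorem rpow_sub_one_le {p σ y : ℝ} (hp : 0 < p) (hσ : 0 < σ)
    (hy : |y| * (σ * σ ^ (p / 2)) ≤ Real.pi) :
    (|y| / Real.pi) ^ (2 * p / (p + 2)) - 1 ≤
      (σ ^ p)⁻¹ * min 1 (|y| * σ ^ (p / 2)) ^ 2 := by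
  have hπ := Real.pi_gt_three
  have hε : 0 < σ ^ (p / 2) := Real.rpow_pos_of_pos hσ _
  have hε2 : (σ ^ (p / 2)) ^ 2 = σ ^ p := by
    rw [← Real.rpow_natCast, ← Real.rpow_mul hσ.le]; congr 1; push_cast; ring
  rcases le_total 1 (|y| * σ ^ (p / 2)) with h | h
  · rw [min_eq_left h, one_pow, mul_one]
    have h1 : |y| / Real.pi ≤ σ ^ (-(1 + p / 2)) := by
      rw [Real.rpow_neg hσ.le, Real.rpow_add hσ, Real.rpow_one, div_le_iff₀ Real.pi_pos,
        ← div_eq_inv_mul, le_div_iff₀ (by positivity)]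
      exact hy
    have h2 : (|y| / Real.pi) ^ (2 * p / (p + 2)) ≤ (σ ^ (-(1 + p / 2))) ^ (2 * p / (p + 2)) := by
      gcongr
    -- The exponent 2p/(p+2) is chosen for this: at the edge |θ| = π, |y| is of order σ^{-(1+p/2)}
    -- while the available decay is σ^{-p}.
    have h3 : (σ ^ (-(1 + p / 2))) ^ (2 * p / (p + 2)) = (σ ^ p)⁻¹ := by
      rw [← Real.rpow_mul hσ.le, ← Real.rpow_neg hσ.le]
      congr 1
      field_simp
      ring
    linarith
  · have h1 : (σ ^ p)⁻¹ * min 1 (|y| * σ ^ (p / 2)) ^ 2 = |y| ^ 2 := by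
      rw [min_eq_right h, mul_pow, hε2]
      field_simp
    rw [h1]
    -- In the quadratic regime 2p/(p+2) ≤ 2 suffices when |y| ≥ π; the subtracted 1 covers smaller
    -- |y|.
    rcases le_total (|y| / Real.pi) 1 with h2 | h2
    · have := Real.rpow_le_one (by positivity) h2 (by positivity : 0 ≤ 2 * p / (p + 2))
      nlinarith [sq_nonneg |y|]
    · have h3 : (|y| / Real.pi) ^ (2 * p / (p + 2)) ≤ (|y| / Real.pi) ^ (2 : ℝ) := by
        refine Real.rpow_le_rpow_of_exponent_le h2 ?_
        rw [div_le_iff₀ (by positivity)]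
        linarith
      have h4 : |y| / Real.pi ≤ |y| := div_le_self (abs_nonneg _) (by linarith)
      have h5 : (|y| / Real.pi) ^ (2 : ℝ) ≤ |y| ^ 2 := by
        rw [Real.rpow_two]; gcongr
      linarith

/-! ### Tilted intensities -/

/-- The tilted intensities `q j ^ (p - 1) e ^ (-σ j)`. -/
noncomputable def intensity (q p σ : ℝ) (j : ℕ) : ℝ := q * (j : ℝ) ^ (p - 1) * Real.exp (-(σ * j))

theorem intensity_nonneg {q : ℝ} (hq : 0 ≤ q) (p σ : ℝ) (j : ℕ) : 0 ≤ intensity q p σ j := by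
  unfold intensity; positivity

/-- The factor h^j is itself a tilt, so h drops out of the conditioned law. -/
theorem intensity_eq {q h p σ : ℝ} (hh : 0 < h) (j : ℕ) :
    intensity q p σ j = param q h p j * (Real.exp (-σ) / h) ^ j := by
  rw [intensity, param, div_pow, ← Real.exp_nat_mul]
  field_simp

theorem moment_intensity (q p σ : ℝ) (N k : ℕ) :
    moment (intensity q p σ) N k =
      q * ∑ j ∈ Finset.Icc 1 N, (j : ℝ) ^ (p + k - 1) * Real.exp (-(σ * j)) := by
  rw [moment, Finset.mul_sum]
  refine Finset.sum_congr rfl fun j hj => ?_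
  have hj : (0 : ℝ) < j := by exact_mod_cast (Finset.mem_Icc.1 hj).1
  rw [intensity, show p + k - 1 = p - 1 + k by ring, Real.rpow_add_natCast hj.ne']
  ring

theorem exists_le_intensity {q : ℝ} (hq : 0 < q) (p : ℝ) :
    ∃ c > 0, ∀ σ : ℝ, 0 < σ → ∀ j : ℕ, 1 ≤ j * σ → j * σ ≤ 6 →
      c * σ * (σ ^ p)⁻¹ ≤ intensity q p σ j := by
  refine ⟨q * min 1 (6 ^ (p - 1)) * Real.exp (-6), by positivity, fun σ hσ j h1 h6 => ?_⟩
  have hj : (0 : ℝ) < j := by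
    by_contra h
    have : (j : ℝ) = 0 := le_antisymm (not_lt.1 h) (by positivity)
    rw [this] at h1; norm_num at h1
  have hx : min 1 (6 ^ (p - 1)) ≤ ((j : ℝ) * σ) ^ (p - 1) := by
    rcases le_total 0 (p - 1) with h | h
    · exact (min_le_left _ _).trans (Real.one_le_rpow h1 h)
    · exact (min_le_right _ _).trans (Real.rpow_le_rpow_of_nonpos (by positivity) h6 h)
  have he : Real.exp (-6) ≤ Real.exp (-(σ * j)) := Real.exp_le_exp.2 (by linarith)
  have hσp : ((j : ℝ) * σ) ^ (p - 1) * (σ * (σ ^ p)⁻¹) = (j : ℝ) ^ (p - 1) := by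
    rw [Real.mul_rpow hj.le hσ.le, Real.rpow_sub_one hσ.ne']
    have := (Real.rpow_pos_of_pos hσ p).ne'
    field_simp
  rw [intensity, ← hσp]
  have hpos : 0 ≤ σ * (σ ^ p)⁻¹ := by positivity
  calc q * min 1 (6 ^ (p - 1)) * Real.exp (-6) * σ * (σ ^ p)⁻¹
      = q * (min 1 (6 ^ (p - 1)) * (σ * (σ ^ p)⁻¹)) * Real.exp (-6) := by ring
    _ ≤ _ := by gcongr

/-- Completing the square in y; the Schur complement g₀ - g₁²/g₂ is the variance of the first
Gaussian coordinate conditioned on the second. -/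
theorem integral_exp_quadratic {g₀ g₁ g₂ : ℝ} (hg : 0 < g₂) (τ : ℝ) :
    ∫ y : ℝ, Complex.exp ((-(τ ^ 2 * g₀ + 2 * τ * y * g₁ + y ^ 2 * g₂) / 2 : ℝ) : ℂ) =
      Complex.exp ((-(τ ^ 2 * (g₀ - g₁ ^ 2 / g₂)) / 2 : ℝ) : ℂ) *
        (√(Real.pi / (g₂ / 2)) : ℝ) := by
  have h1 : ∀ y : ℝ, Complex.exp ((-(τ ^ 2 * g₀ + 2 * τ * y * g₁ + y ^ 2 * g₂) / 2 : ℝ) : ℂ) =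
      Complex.exp ((-(τ ^ 2 * (g₀ - g₁ ^ 2 / g₂)) / 2 : ℝ) : ℂ) *
        ((Real.exp (-(g₂ / 2) * (y + τ * g₁ / g₂) ^ 2) : ℝ) : ℂ) := by
    intro y
    rw [Complex.ofReal_exp, ← Complex.exp_add, ← Complex.ofReal_add]
    congr 2
    field_simp
    ring
  simp_rw [h1]
  rw [integral_const_mul, integral_complex_ofReal,
    integral_add_right_eq_self (fun y : ℝ => Real.exp (-(g₂ / 2) * y ^ 2)), integral_gaussian]

/-! ### Choice of the tilt and the resulting normalization -/

/-- The tilt parameter `σ`, solution of `q Γ(p + 1) σ ^ (-(p + 1)) = N`. -/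
noncomputable def tilt (q p : ℝ) (N : ℕ) : ℝ := (q * Real.Gamma (p + 1) / N) ^ (1 / (p + 1))

section Tilt

variable {q p : ℝ}

theorem tilt_pos (hq : 0 < q) (hp : 0 < p) {N : ℕ} (hN : 0 < N) : 0 < tilt q p N := by
  have := Real.Gamma_pos_of_pos (show 0 < p + 1 by linarith)
  have : (0 : ℝ) < N := by exact_mod_cast hN
  unfold tilt; positivity

theorem tilt_rpow (hq : 0 < q) (hp : 0 < p) (N : ℕ) :
    tilt q p N ^ (p + 1) = q * Real.Gamma (p + 1) / N := by
  have := Real.Gamma_pos_of_pos (show 0 < p + 1 by linarith)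
  rw [tilt, ← Real.rpow_mul (by positivity), one_div_mul_cancel (by positivity), Real.rpow_one]

theorem natCast_eq_tilt (hq : 0 < q) (hp : 0 < p) {N : ℕ} (hN : 0 < N) :
    (N : ℝ) = q * Real.Gamma (p + 1) * tilt q p N ^ (-(p + 1)) := by
  have h1 := Real.Gamma_pos_of_pos (show 0 < p + 1 by linarith)
  have h2 : (0 : ℝ) < N := by exact_mod_cast hN
  rw [Real.rpow_neg (tilt_pos hq hp hN).le, tilt_rpow hq hp]
  field_simp

theorem tendsto_tilt (hp : 0 < p) : Tendsto (tilt q p) atTop (nhds 0) := by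
  have h1 : Tendsto (fun N : ℕ => q * Real.Gamma (p + 1) / N) atTop (nhds 0) :=
    tendsto_const_div_atTop_nhds_zero_nat _
  have h2 := h1.rpow_const (p := 1 / (p + 1)) (Or.inr (by positivity))
  rwa [Real.zero_rpow (by positivity)] at h2

theorem sq_rpow_half {σ : ℝ} (hσ : 0 < σ) : (σ ^ (p / 2)) ^ 2 = σ ^ p := by
  rw [← Real.rpow_natCast, ← Real.rpow_mul hσ.le]; congr 1; push_cast; ring

/-- Makes the centring `G 1 / (ε N ^ 2 * σ N)` of `tendsto_logChar` exactly N, as Fourier inversion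
requires. -/
theorem natCast_eq_div (hq : 0 < q) (hp : 0 < p) {N : ℕ} (hN : 0 < N) :
    (N : ℝ) = q * Real.Gamma (p + 1) / ((tilt q p N ^ (p / 2)) ^ 2 * tilt q p N) := by
  have h := tilt_pos hq hp hN
  rw [sq_rpow_half h, ← Real.rpow_add_one h.ne', div_eq_mul_inv, ← Real.rpow_neg h.le]
  exact natCast_eq_tilt hq hp hN

/-- The centring of the number of groups is the mean in the tilted Poisson model. -/
theorem QTilde_mul_eq (hq : 0 < q) (hp : 0 < p) {N : ℕ} (hN : 0 < N) :
    QTilde q p * (N : ℝ) ^ (p / (p + 1)) =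
      q * Real.Gamma p / (tilt q p N ^ (p / 2)) ^ 2 := by
  have h := tilt_pos hq hp hN
  have hG := Real.Gamma_pos_of_pos (show 0 < p + 1 by linarith)
  have hp1 : 0 < p + 1 := by linarith
  set B := q * Real.Gamma (p + 1) with hB
  have hB0 : 0 < B := by positivity
  have h1 : (N : ℝ) ^ (p / (p + 1)) = B ^ (p / (p + 1)) * tilt q p N ^ (-p) := by
    rw [natCast_eq_tilt hq hp hN, Real.mul_rpow hB0.le (by positivity), ← Real.rpow_mul h.le]
    congr 2
    field_simp
  have h2 : QTilde q p = p⁻¹ * B ^ (1 / (p + 1)) := by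
    rw [QTilde, Q, hB, Real.mul_rpow hq.le hG.le]; ring
  have h3 : B ^ (1 / (p + 1)) * B ^ (p / (p + 1)) = B := by
    rw [← Real.rpow_add hB0, ← add_div, add_comm 1 p, div_self hp1.ne', Real.rpow_one]
  rw [sq_rpow_half h, h1, h2, Real.rpow_neg h.le]
  have h4 : B = q * (p * Real.Gamma p) := by rw [hB, Real.Gamma_add_one hp.ne']
  calc p⁻¹ * B ^ (1 / (p + 1)) * (B ^ (p / (p + 1)) * (tilt q p N ^ p)⁻¹)
      = p⁻¹ * (B ^ (1 / (p + 1)) * B ^ (p / (p + 1))) * (tilt q p N ^ p)⁻¹ := by ring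
    _ = q * Real.Gamma p / tilt q p N ^ p := by
        rw [h3, h4]; field_simp

theorem sqrt_dTilde_mul_eq (hq : 0 < q) (hp : 0 < p) {N : ℕ} (hN : 0 < N) :
    √(dTilde q p) * (N : ℝ) ^ (p / (2 * p + 2)) =
      √(q * Real.Gamma p / (p + 1)) / tilt q p N ^ (p / 2) := by
  have h := tilt_pos hq hp hN
  have hε : 0 < tilt q p N ^ (p / 2) := Real.rpow_pos_of_pos h _
  have hG := Real.Gamma_pos_of_pos hp
  have h1 : (N : ℝ) ^ (p / (2 * p + 2)) = √((N : ℝ) ^ (p / (p + 1))) := by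
    rw [Real.sqrt_eq_rpow, ← Real.rpow_mul (by positivity)]
    congr 1
    field_simp
  have h2 : dTilde q p = QTilde q p / (p + 1) := by rw [dTilde, d, QTilde]; ring
  rw [h1, h2, ← Real.sqrt_mul' _ (by positivity), div_mul_eq_mul_div, QTilde_mul_eq hq hp hN,
    div_right_comm, Real.sqrt_div' _ (by positivity), Real.sqrt_sq hε.le]

theorem tendsto_moment_intensity (hq : 0 < q) (hp : 0 < p) (k : ℕ) :
    Tendsto (fun N => (tilt q p N ^ (p / 2)) ^ 2 * tilt q p N ^ k *
      moment (intensity q p (tilt q p N)) N k) atTop (nhds (q * Real.Gamma (p + k))) := by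
  have hG := Real.Gamma_pos_of_pos (show 0 < p + 1 by linarith)
  have hk : (0 : ℝ) ≤ k := by positivity
  have h := (tendsto_scaled_sum (s := p + k) hp (mul_pos hq hG) (by linarith)
    ((eventually_gt_atTop 0).mono fun N hN => tilt_pos hq hp hN) (tendsto_tilt hp)
    ((eventually_gt_atTop 0).mono fun N hN => natCast_eq_tilt hq hp hN)).const_mul q
  refine h.congr' ?_
  filter_upwards [eventually_gt_atTop 0] with N hN
  have hσ := tilt_pos hq hp hN
  rw [moment_intensity, sq_rpow_half hσ, Real.rpow_add_natCast hσ.ne']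
  ring

theorem tendsto_moment_intensity_sub (hq : 0 < q) (hp : 0 < p) (k : ℕ) :
    Tendsto (fun N => (tilt q p N ^ (p / 2))⁻¹ * ((tilt q p N ^ (p / 2)) ^ 2 * tilt q p N ^ k *
      moment (intensity q p (tilt q p N)) N k - q * Real.Gamma (p + k))) atTop (nhds 0) := by
  have hG := Real.Gamma_pos_of_pos (show 0 < p + 1 by linarith)
  have hk : (0 : ℝ) ≤ k := by positivity
  have h := (tendsto_scaled_sum_sub (s := p + k) hp (mul_pos hq hG) (by linarith)
    ((eventually_gt_atTop 0).mono fun N hN => tilt_pos hq hp hN) (tendsto_tilt hp)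
    ((eventually_gt_atTop 0).mono fun N hN => natCast_eq_tilt hq hp hN)).const_mul q
  rw [mul_zero] at h
  refine h.congr' ?_
  filter_upwards [eventually_gt_atTop 0] with N hN
  have hσ := tilt_pos hq hp hN
  rw [moment_intensity, sq_rpow_half hσ, Real.rpow_add_natCast hσ.ne']
  ring

/-! ### Laplace's method -/

/-- The rescaled characteristic function has an integrable majorant. -/
theorem exists_norm_exp_logChar_le (hq : 0 < q) (hp : 0 < p) :
    ∃ c > 0, ∀ᶠ N : ℕ in atTop, ∀ m M u y : ℝ,
      |y| * (tilt q p N * tilt q p N ^ (p / 2)) ≤ Real.pi →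
      ‖Complex.exp (logChar (intensity q p (tilt q p N)) N m M u
        (y * (tilt q p N * tilt q p N ^ (p / 2))))‖ ≤
      Real.exp (c - c * (|y| / Real.pi) ^ (2 * p / (p + 2))) := by
  obtain ⟨c, hc, hcl⟩ := exists_le_intensity hq p
  have hG := Real.Gamma_pos_of_pos (show 0 < p + 1 by linarith)
  refine ⟨c / (2 * Real.pi ^ 2), by positivity, ?_⟩
  have hσ0 := tendsto_tilt (q := q) hp
  have hσp : Tendsto (fun N => tilt q p N ^ p) atTop (nhds 0) := by
    have := hσ0.rpow_const (p := p) (Or.inr hp.le)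
    rwa [Real.zero_rpow hp.ne'] at this
  filter_upwards [eventually_gt_atTop 0, hσ0.eventually (gt_mem_nhds one_pos),
    hσp.eventually (gt_mem_nhds (show 0 < q * Real.Gamma (p + 1) / 6 by positivity))]
    with N hN h1 h2 m M u y hy
  have hσ := tilt_pos hq hp hN
  have hNeq := natCast_eq_div hq hp hN
  rw [sq_rpow_half hσ] at hNeq
  set σ := tilt q p N with hσdef
  have hε : 0 < σ ^ (p / 2) := Real.rpow_pos_of_pos hσ _
  have hσp0 : 0 < σ ^ p := Real.rpow_pos_of_pos hσ _
  -- The window jσ ≤ 6 lies below the truncation, because Nσ = q Γ(p+1) σ^{-p} is eventually at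
  -- least 6.
  have h6 : 6 / σ ≤ N := by
    rw [hNeq, div_le_div_iff₀ hσ (by positivity)]
    nlinarith
  have hθ : |y * (σ * σ ^ (p / 2))| = |y| * (σ * σ ^ (p / 2)) := by
    rw [abs_mul, abs_of_pos (mul_pos hσ hε)]
  have hlow := min_sq_le_sum_one_sub_cos (intensity_nonneg hq.le p σ) hσ h1.le
    (by positivity : 0 ≤ c * σ * (σ ^ p)⁻¹) (hcl σ hσ) h6 (hθ.trans_le hy) u
  rw [norm_exp_logChar, Real.exp_le_exp]
  have hineq := rpow_sub_one_le hp hσ hy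
  have hdiv : |y * (σ * σ ^ (p / 2))| / σ = |y| * σ ^ (p / 2) := by
    rw [hθ]; field_simp
  rw [hdiv] at hlow
  have hrw : c * σ * (σ ^ p)⁻¹ / (2 * Real.pi ^ 2 * σ) * min 1 (|y| * σ ^ (p / 2)) ^ 2 =
      c / (2 * Real.pi ^ 2) * ((σ ^ p)⁻¹ * min 1 (|y| * σ ^ (p / 2)) ^ 2) := by
    field_simp
  rw [hrw] at hlow
  have := mul_le_mul_of_nonneg_left hineq (by positivity : 0 ≤ c / (2 * Real.pi ^ 2))
  linarith

/-- Laplace's method for the Fourier integral at the scale `u = τ ε`. -/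
theorem tendsto_integral_exp_logChar (hq : 0 < q) (hp : 0 < p) (τ : ℝ) :
    Tendsto (fun N : ℕ => (((tilt q p N * tilt q p N ^ (p / 2))⁻¹ : ℝ) : ℂ) *
      ∫ θ in (-Real.pi)..Real.pi, Complex.exp (logChar (intensity q p (tilt q p N)) N
        (q * Real.Gamma p / (tilt q p N ^ (p / 2)) ^ 2) N (τ * tilt q p N ^ (p / 2)) θ))
      atTop (nhds (Complex.exp ((-(τ ^ 2 * (q * Real.Gamma p / (p + 1))) / 2 : ℝ) : ℂ) *
        (√(Real.pi / (q * Real.Gamma (p + 2) / 2)) : ℝ))) := by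
  have hG0 := Real.Gamma_pos_of_pos hp
  have hG2 := Real.Gamma_pos_of_pos (show 0 < p + 2 by linarith)
  have hconst : q * Real.Gamma p - (q * Real.Gamma (p + 1)) ^ 2 / (q * Real.Gamma (p + 2)) =
      q * Real.Gamma p / (p + 1) := by
    have e2 : Real.Gamma (p + 2) = (p + 1) * (p * Real.Gamma p) := by
      rw [show p + 2 = p + 1 + 1 by ring, Real.Gamma_add_one (by positivity),
        Real.Gamma_add_one hp.ne']
    rw [e2, Real.Gamma_add_one hp.ne']
    field_simp
    ring
  rw [← hconst, ← integral_exp_quadratic (mul_pos hq hG2)]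
  set σ := tilt q p with hσdef
  set ε : ℕ → ℝ := fun N => σ N ^ (p / 2) with hε
  have hσpos : ∀ᶠ N in atTop, 0 < σ N := (eventually_gt_atTop 0).mono fun N hN => tilt_pos hq hp hN
  have hεpos : ∀ᶠ N in atTop, 0 < ε N := hσpos.mono fun N hN => Real.rpow_pos_of_pos hN _
  have hσ0 : Tendsto σ atTop (nhds 0) := tendsto_tilt hp
  have hε0 : Tendsto ε atTop (nhds 0) := by
    have := hσ0.rpow_const (p := p / 2) (Or.inr (half_pos hp).le)
    rwa [Real.zero_rpow (half_pos hp).ne'] at this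
  have hβpos : ∀ᶠ N in atTop, 0 < σ N * ε N := by
    filter_upwards [hσpos, hεpos] with N h1 h2 using mul_pos h1 h2
  have hβ0 : Tendsto (fun N => σ N * ε N) atTop (nhds 0) := by simpa using hσ0.mul hε0
  -- The substitution θ = yσε turns [-π, π] into an interval growing to ℝ; the indicator allows
  -- dominated convergence on the whole line.
  set F : ℕ → ℝ → ℂ := fun N y => (Set.Ioc (-Real.pi / (σ N * ε N)) (Real.pi / (σ N * ε N))).indicator
    (fun y => Complex.exp (logChar (intensity q p (σ N)) N (q * Real.Gamma p / ε N ^ 2) N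
      (τ * ε N) (y * (σ N * ε N)))) y with hF
  have hcont : ∀ N : ℕ, Continuous fun y : ℝ => Complex.exp (logChar (intensity q p (σ N)) N
      (q * Real.Gamma p / ε N ^ 2) N (τ * ε N) (y * (σ N * ε N))) := fun N => by
    unfold logChar; fun_prop
  obtain ⟨c, hc, hdom⟩ := exists_norm_exp_logChar_le hq hp
  have hlim : Tendsto (fun N => ∫ y, F N y) atTop (nhds (∫ y : ℝ,
      Complex.exp ((-(τ ^ 2 * (q * Real.Gamma p) + 2 * τ * y * (q * Real.Gamma (p + 1)) +
        y ^ 2 * (q * Real.Gamma (p + 2))) / 2 : ℝ) : ℂ))) := by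
    refine tendsto_integral_filter_of_dominated_convergence
      (fun y => Real.exp (c - c * (|y| / Real.pi) ^ (2 * p / (p + 2)))) ?_ ?_ ?_ ?_
    · exact Eventually.of_forall fun N =>
        ((hcont N).aestronglyMeasurable).indicator measurableSet_Ioc
    · filter_upwards [hdom, hβpos] with N h1 h2
      refine ae_of_all _ fun y => ?_
      by_cases hy : y ∈ Set.Ioc (-Real.pi / (σ N * ε N)) (Real.pi / (σ N * ε N))
      · simp only [hF, Set.indicator_of_mem hy]
        refine h1 _ _ _ _ ?_
        rw [← le_div_iff₀ h2, abs_le, ← neg_div]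
        exact ⟨hy.1.le, hy.2⟩
      · simp only [hF, Set.indicator_of_notMem hy, norm_zero]
        exact (Real.exp_pos _).le
    · have h := (integrable_exp_neg_mul_abs_rpow
        (c := c * (Real.pi ^ (2 * p / (p + 2)))⁻¹) (a := 2 * p / (p + 2))
        (by positivity) (by positivity)).const_mul (Real.exp c)
      refine h.congr (ae_of_all _ fun y => ?_)
      simp only
      rw [← Real.exp_add, Real.div_rpow (abs_nonneg y) Real.pi_pos.le]
      congr 1
      ring
    · refine ae_of_all _ fun y => ?_
      have h := (Complex.continuous_exp.tendsto _).comp (tendsto_logChar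
        (l := fun N => intensity q p (σ N)) (fun N => intensity_nonneg hq.le p (σ N)) hσpos hεpos
        hε0 (G := fun k => q * Real.Gamma (p + k)) (fun k => tendsto_moment_intensity hq hp k)
        (fun k _ => tendsto_moment_intensity_sub hq hp k) τ y)
      simp only [Nat.cast_zero, add_zero, Nat.cast_one, Nat.cast_ofNat] at h
      refine h.congr' ?_
      have hin : ∀ᶠ N in atTop, |y| * (σ N * ε N) < Real.pi := by
        have := hβ0.const_mul |y|
        rw [mul_zero] at this
        exact this.eventually (gt_mem_nhds Real.pi_pos)
      filter_upwards [hin, hβpos, eventually_gt_atTop 0] with N h1 h2 h3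
      rw [← lt_div_iff₀ h2, abs_lt, ← neg_div] at h1
      simp only [hF, Set.indicator_of_mem (Set.mem_Ioc.2 ⟨h1.1, h1.2.le⟩), Function.comp_apply]
      rw [← natCast_eq_div hq hp h3]
  refine hlim.congr' ?_
  filter_upwards [hβpos] with N h1
  simp only [hF]
  rw [integral_indicator measurableSet_Ioc, ← intervalIntegral.integral_of_le
    (div_le_div_of_nonneg_right (by linarith [Real.pi_pos]) h1.le),
    intervalIntegral.integral_comp_mul_right (fun θ => Complex.exp (logChar (intensity q p (σ N)) N
      (q * Real.Gamma p / ε N ^ 2) N (τ * ε N) θ)) h1.ne',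
    div_mul_cancel₀ _ h1.ne', div_mul_cancel₀ _ h1.ne', Complex.real_smul]

end Tilt

end GroupCLT

/-! ### Convergence of characteristic functions -/

theorem theorem4p7 (p q h : ℝ) (hp : 0 < p) (hq : 0 < q) (hh : 0 < h) :
    TendstoInDistribution (fun N : ℕ => GroupCLT.normalizedNumGroups q p N) atTop
      (fun x : ℝ => x)
      (fun N : ℕ =>
        GroupCLT.equilibriumMeasure (GroupCLT.param q h p) (GroupCLT.param_pos hq hh p) N)
      (gaussianReal 0 1) := by
  refine ⟨fun N => measurable_from_top.aemeasurable, by fun_prop, ?_⟩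
  refine ProbabilityMeasure.tendsto_iff_tendsto_charFun.2 fun t => ?_
  have hG0 := Real.Gamma_pos_of_pos hp
  have hG2 := Real.Gamma_pos_of_pos (show 0 < p + 2 by linarith)
  set v : ℝ := q * Real.Gamma p / (p + 1) with hv
  have hv0 : 0 < v := by positivity
  have hK : ((√(Real.pi / (q * Real.Gamma (p + 2) / 2)) : ℝ) : ℂ) ≠ 0 := by
    exact_mod_cast (by positivity : 0 < √(Real.pi / (q * Real.Gamma (p + 2) / 2))).ne'
  -- Numerator at τ = t/√v over denominator at τ = 0: the Gaussian constant and the scale factor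
  -- 1/(σε) cancel.
  have hlim := (GroupCLT.tendsto_integral_exp_logChar hq hp (t / √v)).div
    (GroupCLT.tendsto_integral_exp_logChar hq hp 0) (by simpa using hK)
  have hgauss : charFun ((gaussianReal 0 1).map fun x : ℝ => x) t =
      Complex.exp ((-((t / √v) ^ 2 * v) / 2 : ℝ) : ℂ) := by
    rw [Measure.map_id', charFun_gaussianReal, div_pow, Real.sq_sqrt hv0.le,
      div_mul_cancel₀ _ hv0.ne']
    congr 1
    push_cast
    simp
    ring
  simp only [ProbabilityMeasure.coe_mk]
  rw [hgauss]
  have hval : Complex.exp ((-((t / √v) ^ 2 * v) / 2 : ℝ) : ℂ) =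
      Complex.exp ((-((t / √v) ^ 2 * v) / 2 : ℝ) : ℂ) *
        (√(Real.pi / (q * Real.Gamma (p + 2) / 2)) : ℝ) /
      (Complex.exp ((-((0 : ℝ) ^ 2 * v) / 2 : ℝ) : ℂ) *
        (√(Real.pi / (q * Real.Gamma (p + 2) / 2)) : ℝ)) := by
    rw [mul_div_mul_right _ _ hK]
    simp
  rw [hval]
  refine hlim.congr' ?_
  filter_upwards [eventually_gt_atTop 0] with N hN
  have hσ := GroupCLT.tilt_pos hq hp hN
  set σ := GroupCLT.tilt q p N with hσdef
  have hε : 0 < σ ^ (p / 2) := Real.rpow_pos_of_pos hσ _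
  have hβ : (((σ * σ ^ (p / 2))⁻¹ : ℝ) : ℂ) ≠ 0 := by
    exact_mod_cast (by positivity : 0 < (σ * σ ^ (p / 2))⁻¹).ne'
  have hX : GroupCLT.normalizedNumGroups q p N = fun η => ((GroupCLT.numGroups η : ℝ) -
      q * Real.Gamma p / (σ ^ (p / 2)) ^ 2) / (√v / σ ^ (p / 2)) := by
    funext η
    rw [GroupCLT.normalizedNumGroups, GroupCLT.QTilde_mul_eq hq hp hN,
      GroupCLT.sqrt_dTilde_mul_eq hq hp hN]
  have hchar := GroupCLT.charFun_map_numGroups (GroupCLT.param_pos hq hh p)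
    (r := Real.exp (-σ) / h) (by positivity) (N := N) (l := GroupCLT.intensity q p σ)
    (fun j _ => GroupCLT.intensity_eq hh j) (q * Real.Gamma p / (σ ^ (p / 2)) ^ 2)
    (√v / σ ^ (p / 2)) t
  rw [← hX] at hchar
  rw [hchar, Pi.div_apply, mul_div_mul_left _ _ hβ, zero_mul, div_div_eq_mul_div,
    div_mul_eq_mul_div]
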